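/- Let $d\ge 1$, $\gamma\neq 0$, let $\mathbf W$ be a standard $d$-dimensional Brownian motion relative to a filtration $(\mathcal F_t)_{t\ge0}$ on a probability space, and let $A\in\mathbb R^{d\times d}$ be given by $[A]_{ij}=\delta_{ij}+i\,\delta_{1j}$ for $1\le i,j\le d$. Consider the linear SDE $$d\Theta_t=A\Theta_t\,dt+\gamma\,d\mathbf W_t,\qquad \Theta_0=0 .$$ 1. The drift is decoupled, with the first coordinate $\Phi=\theta_1$ as global variable: there are functions $u^i$ such that, for every $i$, $[A\theta]_i=u^i(t,\theta_i,\Phi)$ for all $t$ and $\theta$. 2. The SDE has a solution (an adapted process with a.s. continuous paths such that a.s. $\Theta_t=\int_0^tA\Theta_s\,ds+\gamma\mathbf W_t$ for all $t\ge0$). Every solution satisfies, for each $t\ge0$, almost surely $\Theta_t=\gamma\int_0^t e^{A(t-s)}\,d\mathbf W_s$ (Wiener integral). It is a Gaussian process with mean zero, and $\Theta_t\sim\mathcal N(0,\Sigma(t))$ with covariance matrix $$\Sigma(t)=\gamma^2\int_0^te^{A(t-s)}\bigl(e^{A(t-s)}\bigr)^{\top}ds .$$ It is Markov: for $0\le s\le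 t$ and every Borel set $B$, $\mathbb P(\Theta_t\in B\mid\mathcal F_s)=\mathcal N\bigl(e^{A(t-s)}\Theta_s,\Sigma(t-s)\bigr)(B)$ almost surely. 3. For every $t>0$ all entries of $\Sigma(t)$ are nonzero (the covariance matrix is dense). 4. For every $t>0$ the law of $\Theta_t$, and for every $x\in\mathbb R^d$ the transition law $\mathcal N(e^{At}x,\Sigma(t))$, has a Lebesgue density, and this density does not factor: for no set $S$ of coordinates with $\emptyset\ne S\ne\{1,\dots,d\}$ is it of the form $q(y_S)\,r(y_{S^c})$ with measurable $q,r\ge0$. 5. For $d=3$ and all $t\ge0$, writing $e_k=(e^{kt}-1)/k$ and $g=e_4-2e_3+e_2$, $$\Sigma(t)=\gamma^2\begin{pmatrix} e_4&2(e_4-e_3)&3(e_4-e_3)\\ 2(e_4-e_3)&e_2+4g&6g\\ 3(e_4-e_3)&6g&e_2+9g\end{pmatrix}.$$ In particular, for $d\ge2$ an SDE with a decoupled drift can have transition densities that do not factor. -/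

import Mathlib

open MeasureTheory ProbabilityTheory Filter Topology
open scoped NNReal ENNReal Matrix

noncomputable section

namespace LocalGlobal

variable {Ω : Type*} {mΩ : MeasurableSpace Ω} {d : ℕ}

/-- `W` is a standard `d`-dimensional Brownian motion (Wiener process) relative to the
filtration `ℱ`. -/
structure IsBrownianMotion (W : ℝ≥0 → Ω → EuclideanSpace ℝ (Fin d))
    (ℱ : Filtration ℝ≥0 mΩ) (P : Measure Ω) : Prop where
  adapted : StronglyAdapted ℱ W
  coord : ∀ i, IsBrownianReal (fun t ω => W t ω i) P
  indep_coord : iIndepFun (fun i ω (t : ℝ≥0) => W t ω i) P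
  indep_increment : ∀ s t : ℝ≥0, s ≤ t →
    Indep (MeasurableSpace.comap (fun ω => W t ω - W s ω) inferInstance) (ℱ s) P

/-- `Θ` is a solution of the SDE with additive noise
`dΘ_t = b(t, Θ_t) dt + σ dW_t`, `Θ_0 = x₀`, that is, an adapted process with almost surely
continuous paths such that almost surely, for all `t`,
`Θ_t = x₀ + ∫_0^t b(s, Θ_s) ds + σ W_t`. -/
structure IsSDESolution (b : ℝ≥0 → EuclideanSpace ℝ (Fin d) → EuclideanSpace ℝ (Fin d))
    (σ : ℝ) (x₀ : EuclideanSpace ℝ (Fin d)) (W : ℝ≥0 → Ω → EuclideanSpace ℝ (Fin d))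
    (ℱ : Filtration ℝ≥0 mΩ) (P : Measure Ω)
    (Θ : ℝ≥0 → Ω → EuclideanSpace ℝ (Fin d)) : Prop where
  adapted : StronglyAdapted ℱ Θ
  cont : ∀ᵐ ω ∂P, Continuous (fun t => Θ t ω)
  integrable : ∀ᵐ ω ∂P, ∀ t : ℝ≥0, IntervalIntegrable
    (fun s : ℝ => b s.toNNReal (Θ s.toNNReal ω)) volume 0 t
  eq : ∀ᵐ ω ∂P, ∀ t : ℝ≥0,
    Θ t ω = x₀ + (∫ s in (0 : ℝ)..t, b s.toNNReal (Θ s.toNNReal ω)) + σ • W t ω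

/-- A drift on `ℝ^d` is decoupled with global coordinate `g` if its `i`-th component depends,
besides time, only on the `i`-th coordinate and on the global one. (Fixed data attached to the
`i`-th coordinate enter through the dependence of `u i` on `i`.) -/
def IsDecoupledDrift (g : Fin d)
    (b : ℝ≥0 → EuclideanSpace ℝ (Fin d) → EuclideanSpace ℝ (Fin d)) : Prop :=
  ∃ u : Fin d → ℝ≥0 → ℝ → ℝ → ℝ, ∀ t θ i, b t θ i = u i t (θ i) (θ g)

/-- A real step function `∑ k, coeff k * 1_{(node k, node (k+1)]}` on the half-line. -/
structure StepFunction where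
  size : ℕ
  node : Fin (size + 1) → ℝ≥0
  mono : Monotone node
  coeff : Fin size → ℝ

/-- The value of a step function at `s`. -/
def StepFunction.eval (φ : StepFunction) (s : ℝ) : ℝ :=
  ∑ k : Fin φ.size,
    (Set.Ioc (φ.node k.castSucc : ℝ) (φ.node k.succ)).indicator (fun _ => φ.coeff k) s

/-- The Wiener integral of a step function with respect to a process `B`. -/
def StepFunction.integral (φ : StepFunction) (B : ℝ≥0 → Ω → ℝ) (ω : Ω) : ℝ :=
  ∑ k : Fin φ.size, φ.coeff k * (B (φ.node k.succ) ω - B (φ.node k.castSucc) ω)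

/-- `Z` is (a version of) the Wiener integral `∫_0^t f(s) dB_s` of the deterministic function
`f`: the limit in `L²(P)` of the integrals of step functions on `[0, t]` converging to `f` in
`L²([0, t])`. -/
def IsWienerIntegral (f : ℝ → ℝ) (t : ℝ≥0) (B : ℝ≥0 → Ω → ℝ) (P : Measure Ω)
    (Z : Ω → ℝ) : Prop :=
  ∃ φ : ℕ → StepFunction,
    (∀ n k, (φ n).node k ≤ t) ∧
    Tendsto (fun n => eLpNorm (fun s => (φ n).eval s - f s) 2
      (volume.restrict (Set.Icc (0 : ℝ) t))) atTop (𝓝 0) ∧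
    Tendsto (fun n => eLpNorm (fun ω => (φ n).integral B ω - Z ω) 2 P) atTop (𝓝 0)

/-- The linear time-homogeneous drift `(t, θ) ↦ A θ`. -/
def linearDrift (A : Matrix (Fin d) (Fin d) ℝ) (_t : ℝ≥0) (θ : EuclideanSpace ℝ (Fin d)) :
    EuclideanSpace ℝ (Fin d) :=
  WithLp.toLp 2 (A *ᵥ θ.ofLp)

/-- `Σ(t) = γ² ∫_0^t exp(A (t - s)) exp(A (t - s))ᵀ ds`, the integral being taken entrywise. -/
def covMatrix (A : Matrix (Fin d) (Fin d) ℝ) (γ : ℝ) (t : ℝ≥0) : Matrix (Fin d) (Fin d) ℝ :=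
  Matrix.of fun i j => γ ^ 2 * ∫ s in (0 : ℝ)..t,
    (NormedSpace.exp (((t : ℝ) - s) • A) * (NormedSpace.exp (((t : ℝ) - s) • A))ᵀ) i j

/-- The Gaussian transition law `N(exp(A r) x, Σ(r))` from `x` over a time span `r`. -/
def transitionLaw (A : Matrix (Fin d) (Fin d) ℝ) (γ : ℝ) (r : ℝ≥0)
    (x : EuclideanSpace ℝ (Fin d)) : Measure (EuclideanSpace ℝ (Fin d)) :=
  multivariateGaussian (WithLp.toLp 2 (NormedSpace.exp ((r : ℝ) • A) *ᵥ x.ofLp))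
    (covMatrix A γ r)

/-- `μ` has a Lebesgue density of the form `q(y_S) * r(y_{Sᶜ})`. -/
def DensityFactorsAcross (S : Finset (Fin d)) (μ : Measure (EuclideanSpace ℝ (Fin d))) : Prop :=
  ∃ (q : ({i // i ∈ S} → ℝ) → ℝ≥0∞) (r : ({i // i ∉ S} → ℝ) → ℝ≥0∞),
    Measurable q ∧ Measurable r ∧
    μ = volume.withDensity (fun y => q (fun i => y i) * r (fun i => y i))

/-- `μ` has a Lebesgue density, and this density is fully joint: it does not factor across any
splitting of the coordinates into two nonempty groups. -/
def HasNonfactoringDensity (μ : Measure (EuclideanSpace ℝ (Fin d))) : Prop :=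
  μ ≪ volume ∧
    ∀ S : Finset (Fin d), S.Nonempty → S ≠ Finset.univ → ¬ DensityFactorsAcross S μ

/-- The matrix `A_{ij} = δ_{ij} + i δ_{1j}`, where `i, j` run through `1, …, d`; with the indices
`0, …, d - 1` of `Fin d` this reads `δ_{ij} + (i + 1) δ_{0j}`. -/
def exampleMatrix (d : ℕ) : Matrix (Fin d) (Fin d) ℝ :=
  Matrix.of fun i j =>
    (if i = j then 1 else 0) + ((i : ℕ) + 1 : ℝ) * (if (j : ℕ) = 0 then 1 else 0)

/-- `∫_0^t exp(k s) ds = (exp(k t) - 1) / k` for `k ≠ 0`. -/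
def expInt (k t : ℝ) : ℝ := (Real.exp (k * t) - 1) / k

/-- The covariance matrix of the three-dimensional example in closed form. -/
def exampleCov3 (γ : ℝ) (t : ℝ) : Matrix (Fin 3) (Fin 3) ℝ :=
  let e₂ := expInt 2 t
  let e₃ := expInt 3 t
  let e₄ := expInt 4 t
  γ ^ 2 • !![e₄,             2 * (e₄ - e₃),                3 * (e₄ - e₃);
             2 * (e₄ - e₃),  e₂ + 4 * (e₄ - 2 * e₃ + e₂),  6 * (e₄ - 2 * e₃ + e₂);
             3 * (e₄ - e₃),  6 * (e₄ - 2 * e₃ + e₂),       e₂ + 9 * (e₄ - 2 * e₃ + e₂)]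

end LocalGlobal

end

/-! The noise is additive, so the equation is solved path by path, without Itô calculus. For a
continuous input `w`, the integral equation `x = x₀ + ∫ L x + w` has exactly one continuous solution
on the half-line, the free evolution `exp(tL) x₀` plus `w(t) + ∫ exp((t-s)L) L w(s) ds`
(`linearResponse_eq`, `eq_exp_add_linearResponse`). Integration by parts shows that the second term
is the limit of the sums `∑ exp(A(r - u_k)) (w(u_{k+1}) - w(u_k))` (`tendsto_sum_exp_apply`).

For Brownian `w` these sums are linear in independent Gaussian increments. If the partition starts
at time `s`, their characteristic functions over any event of `ℱ s` are explicit, and the exponents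
are Riemann sums of the quadratic form of `Σ(r)`. In the limit, the noise accumulated after `s` is
`N(0, Σ(r))` and independent of `ℱ s` (`map_restrict_noise`). Together with the flow property
`ae_eq_add` this gives the law of `Θ_t` and the Markov property. Almost sure limits of centered
Gaussian variables are Gaussian, and the convergence also holds in `L²`; hence `Θ` is a Gaussian
process and a Wiener integral.

If a density factored across `S`, the coordinates in `S` would be independent of the others and the
covariances between the two groups would vanish (`DensityFactorsAcross.indepFun`). Here `A = 1 + N`
with `N` idempotent, so `exp(rA) = e^r 1 + (e^{2r} - e^r) N`. For `r > 0` its entries are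
nonnegative and its first column is positive, so no entry of `Σ(t)` vanishes. Invertibility of
`exp(rA)` makes `Σ(t)` positive definite, which provides the density. -/

/-! ### Riemann and Riemann–Stieltjes sums on uniform partitions -/

/-- The `k`-th point of the uniform partition of `[0, t]` into `n + 1` intervals. -/
noncomputable def uniformGrid (t : ℝ) (n k : ℕ) : ℝ := t * k / (n + 1)

namespace uniformGrid

variable {t : ℝ} {n k : ℕ}

@[simp] lemma zero_right : uniformGrid t n 0 = 0 := by simp [uniformGrid]

@[simp] lemma last : uniformGrid t n (n + 1) = t := by
  have : (n : ℝ) + 1 ≠ 0 := by positivity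
  simp [uniformGrid, this]

lemma sub_eq : uniformGrid t n (k + 1) - uniformGrid t n k = t / (n + 1) := by
  simp only [uniformGrid]; push_cast; ring

lemma nonneg (ht : 0 ≤ t) : 0 ≤ uniformGrid t n k := by
  unfold uniformGrid; positivity

lemma mono (ht : 0 ≤ t) : Monotone (uniformGrid t n) := by
  intro k l h
  unfold uniformGrid
  gcongr

lemma le_last (ht : 0 ≤ t) (hk : k ≤ n + 1) : uniformGrid t n k ≤ t := by
  simpa using mono ht (n := n) hk

end uniformGrid

lemma exists_forall_uniformGrid_abs_sub_lt {g : ℝ → ℝ} (hg : Continuous g) {t : ℝ} (ht : 0 ≤ t)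
    {ε : ℝ} (hε : 0 < ε) :
    ∃ N, ∀ n ≥ N, ∀ k < n + 1,
      ∀ x ∈ Set.Icc (uniformGrid t n k) (uniformGrid t n (k + 1)),
      ∀ y ∈ Set.Icc (uniformGrid t n k) (uniformGrid t n (k + 1)), |g x - g y| < ε := by
  have huc := isCompact_Icc.uniformContinuousOn_of_continuous
    (hg.continuousOn (s := Set.Icc 0 t))
  obtain ⟨δ, hδ, h⟩ := Metric.uniformContinuousOn_iff.1 huc ε hε
  have hlim : Tendsto (fun n : ℕ ↦ t / ((n : ℝ) + 1)) atTop (𝓝 0) := by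
    simpa [div_eq_mul_inv] using (tendsto_one_div_add_atTop_nhds_zero_nat (𝕜 := ℝ)).const_mul t
  obtain ⟨N, hN⟩ := eventually_atTop.1 (hlim.eventually (gt_mem_nhds hδ))
  refine ⟨N, fun n hn k hk x hx y hy ↦ ?_⟩
  have hsub := uniformGrid.sub_eq (t := t) (n := n) (k := k)
  have h0 := uniformGrid.nonneg ht (n := n) (k := k)
  have h1 := uniformGrid.le_last ht (n := n) (k := k + 1) (by lia)
  have hlt := hN n hn
  refine h x ⟨h0.trans hx.1, hx.2.trans h1⟩ y ⟨h0.trans hy.1, hy.2.trans h1⟩ ?_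
  rw [Real.dist_eq, abs_lt]
  constructor <;> linarith [hx.1, hx.2, hy.1, hy.2]

/-- Convergence of tagged Riemann sums of `∫ g h` along uniform partitions. -/
lemma tendsto_sum_uniformGrid {g h : ℝ → ℝ} (hg : Continuous g) (hh : Continuous h) {t : ℝ}
    (ht : 0 ≤ t) {τ : ℕ → ℕ → ℝ}
    (hτ : ∀ n k, τ n k ∈ Set.Icc (uniformGrid t n k) (uniformGrid t n (k + 1))) :
    Tendsto (fun n ↦ ∑ k ∈ Finset.range (n + 1),
      g (τ n k) * ∫ s in uniformGrid t n k..uniformGrid t n (k + 1), h s) atTop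
      (𝓝 (∫ s in 0..t, g s * h s)) := by
  rw [Metric.tendsto_atTop]
  intro ε hε
  set C := ∫ s in 0..t, |h s| with hC
  have hC0 : 0 ≤ C := intervalIntegral.integral_nonneg ht fun _ _ ↦ abs_nonneg _
  -- The `+ 1` keeps the denominator positive when `C = 0` and makes the final inequality strict.
  obtain ⟨N, hN⟩ := exists_forall_uniformGrid_abs_sub_lt hg ht
    (show 0 < ε / (C + 1) by positivity)
  refine ⟨N, fun n hn ↦ ?_⟩
  have hsum (f : ℝ → ℝ) (hf : Continuous f) : ∫ s in 0..t, f s =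
      ∑ k ∈ Finset.range (n + 1), ∫ s in uniformGrid t n k..uniformGrid t n (k + 1), f s := by
    rw [intervalIntegral.sum_integral_adjacent_intervals fun k _ ↦ hf.intervalIntegrable _ _]
    simp
  rw [Real.dist_eq, hsum (fun s ↦ g s * h s) (by fun_prop), ← Finset.sum_sub_distrib]
  calc _ ≤ ∑ k ∈ Finset.range (n + 1), ε / (C + 1) *
        ∫ s in uniformGrid t n k..uniformGrid t n (k + 1), |h s| := by
        refine (Finset.abs_sum_le_sum_abs _ _).trans (Finset.sum_le_sum fun k hk ↦ ?_)
        rw [← intervalIntegral.integral_const_mul, ← intervalIntegral.integral_const_mul,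
          ← intervalIntegral.integral_sub]
        · have hle := uniformGrid.mono ht (n := n) (Nat.le_succ k)
          have hi : IntervalIntegrable (fun s ↦ ε / (C + 1) * |h s|) volume
              (uniformGrid t n k) (uniformGrid t n (k + 1)) :=
            Continuous.intervalIntegrable (by fun_prop) _ _
          rw [← Real.norm_eq_abs]
          refine intervalIntegral.norm_integral_le_of_norm_le hle (ae_of_all _ fun s hs ↦ ?_) hi
          rw [← sub_mul, Real.norm_eq_abs, abs_mul]
          have := hN n hn k (Finset.mem_range.1 hk) _ (hτ n k) s ⟨hs.1.le, hs.2⟩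
          gcongr
        · exact Continuous.intervalIntegrable (by fun_prop) _ _
        · exact Continuous.intervalIntegrable (by fun_prop) _ _
    _ = ε / (C + 1) * C := by rw [← Finset.mul_sum, ← hsum (fun s ↦ |h s|) (by fun_prop)]
    _ < ε := by
        rw [div_mul_eq_mul_div, div_lt_iff₀ (by positivity)]
        nlinarith

lemma tendsto_riemann_sum_uniformGrid {g : ℝ → ℝ} (hg : Continuous g) {t : ℝ} (ht : 0 ≤ t) :
    Tendsto (fun n ↦ ∑ k ∈ Finset.range (n + 1),
      g (uniformGrid t n k) * (uniformGrid t n (k + 1) - uniformGrid t n k)) atTop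
      (𝓝 (∫ s in 0..t, g s)) := by
  have := tendsto_sum_uniformGrid hg (continuous_const (y := (1 : ℝ))) ht
    (τ := fun n k ↦ uniformGrid t n k) fun n k ↦ ⟨le_rfl, uniformGrid.mono ht (Nat.le_succ k)⟩
  simpa using this

/-- Riemann–Stieltjes sums of `∫ f db` along uniform partitions converge for `f` continuously
differentiable and `b` continuous, by integration by parts. -/
lemma tendsto_stieltjes_sum_uniformGrid {f f' b : ℝ → ℝ} (hf : ∀ s, HasDerivAt f (f' s) s)
    (hf' : Continuous f') (hb : Continuous b) (hb0 : b 0 = 0) {t : ℝ} (ht : 0 ≤ t) :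
    Tendsto (fun n ↦ ∑ k ∈ Finset.range (n + 1),
      f (uniformGrid t n k) * (b (uniformGrid t n (k + 1)) - b (uniformGrid t n k))) atTop
      (𝓝 (f t * b t - ∫ s in 0..t, f' s * b s)) := by
  -- Summation by parts leaves the increments of `f` multiplied by `b` at the right endpoint, hence
  -- the right-endpoint tags.
  have key := (tendsto_sum_uniformGrid hb hf' ht
    (τ := fun n k ↦ uniformGrid t n (k + 1))
    fun n k ↦ ⟨uniformGrid.mono ht (Nat.le_succ k), le_rfl⟩).const_sub (f t * b t)
  simp_rw [mul_comm (f' _)]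
  refine key.congr fun n ↦ ?_
  have h1 : ∑ k ∈ Finset.range (n + 1), (f (uniformGrid t n (k + 1)) * b (uniformGrid t n (k + 1))
      - f (uniformGrid t n k) * b (uniformGrid t n k)) = f t * b t := by
    rw [Finset.sum_range_sub (fun k ↦ f (uniformGrid t n k) * b (uniformGrid t n k))]
    simp [hb0]
  rw [← h1, ← Finset.sum_sub_distrib]
  refine Finset.sum_congr rfl fun k _ ↦ ?_
  rw [intervalIntegral.integral_eq_sub_of_hasDerivAt (fun s _ ↦ hf s)
    (hf'.intervalIntegrable _ _)]
  ring

/-! ### Linear integral equations with a continuous input -/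

section LinearODE

variable {E : Type*} [NormedAddCommGroup E] [NormedSpace ℝ E] [CompleteSpace E]

lemma hasDerivAt_exp_const_sub_smul (L : E →L[ℝ] E) (t s : ℝ) :
    HasDerivAt (fun s : ℝ ↦ NormedSpace.exp ((t - s) • L))
      (-(NormedSpace.exp ((t - s) • L) * L)) s := by
  have h := (hasDerivAt_exp_smul_const (𝕂 := ℝ) L (t - s)).scomp s
    ((hasDerivAt_id s).const_sub t)
  simpa [Function.comp_def] using h

lemma hasDerivAt_exp_neg_smul (L : E →L[ℝ] E) (s : ℝ) :
    HasDerivAt (fun s : ℝ ↦ NormedSpace.exp ((-s) • L))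
      (-(NormedSpace.exp ((-s) • L) * L)) s := by
  simpa using hasDerivAt_exp_const_sub_smul L 0 s

lemma exp_smul_mul_exp_smul (L : E →L[ℝ] E) (r s : ℝ) :
    NormedSpace.exp (r • L) * NormedSpace.exp (s • L) = NormedSpace.exp ((r + s) • L) := by
  let := NormedAlgebra.restrictScalars ℚ ℝ (E →L[ℝ] E)
  rw [add_smul]
  exact (NormedSpace.exp_add_of_commute (((Commute.refl L).smul_left r).smul_right s)).symm

lemma continuous_exp_smul (L : E →L[ℝ] E) : Continuous fun s : ℝ ↦ NormedSpace.exp (s • L) :=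
  continuous_iff_continuousAt.2 fun s ↦ (hasDerivAt_exp_smul_const (𝕂 := ℝ) L s).continuousAt

/-- The response `w(t) + ∫_0^t exp((t - s) L) L w(s) ds` of the linear system with generator `L`
to the (integrated) input `w`. -/
noncomputable def linearResponse (L : E →L[ℝ] E) (w : ℝ → E) (t : ℝ) : E :=
  w t + ∫ s in 0..t, NormedSpace.exp ((t - s) • L) (L (w s))

/-- Factoring out `exp(tL)` removes `t` from the integrand, so that the fundamental theorem of
calculus applies in `t`. -/
lemma integral_exp_sub_smul_apply (L : E →L[ℝ] E) {w : ℝ → E} (hw : Continuous w) (t : ℝ) :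
    ∫ s in 0..t, NormedSpace.exp ((t - s) • L) (L (w s)) =
      NormedSpace.exp (t • L) (∫ s in 0..t, NormedSpace.exp ((-s) • L) (L (w s))) := by
  have hc : Continuous fun s : ℝ ↦ NormedSpace.exp ((-s) • L) (L (w s)) :=
    ((continuous_exp_smul L).comp continuous_neg).clm_apply (by fun_prop)
  rw [← ContinuousLinearMap.intervalIntegral_comp_comm _ (hc.intervalIntegrable _ _)]
  congr! 2 with s
  rw [sub_eq_add_neg, ← exp_smul_mul_exp_smul, mul_apply_eq_comp]

lemma continuous_linearResponse (L : E →L[ℝ] E) {w : ℝ → E} (hw : Continuous w) :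
    Continuous (linearResponse L w) := by
  have hc : Continuous fun s : ℝ ↦ NormedSpace.exp ((-s) • L) (L (w s)) :=
    ((continuous_exp_smul L).comp continuous_neg).clm_apply (by fun_prop)
  unfold linearResponse
  simp only [integral_exp_sub_smul_apply L hw]
  refine hw.add ((continuous_exp_smul L).clm_apply ?_)
  exact intervalIntegral.continuous_primitive (fun _ _ ↦ hc.intervalIntegrable _ _) 0

/-- The linear response solves the integral equation `x = ∫ L x + w`. -/
lemma linearResponse_eq (L : E →L[ℝ] E) {w : ℝ → E} (hw : Continuous w) (t : ℝ) :
    linearResponse L w t = (∫ s in 0..t, L (linearResponse L w s)) + w t := by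
  have hc : Continuous fun s : ℝ ↦ NormedSpace.exp ((-s) • L) (L (w s)) :=
    ((continuous_exp_smul L).comp continuous_neg).clm_apply (by fun_prop)
  have hder (s : ℝ) : HasDerivAt (fun t ↦ NormedSpace.exp (t • L)
      (∫ s in 0..t, NormedSpace.exp ((-s) • L) (L (w s)))) (L (linearResponse L w s)) s := by
    have h1 := hasDerivAt_exp_smul_const' (𝕂 := ℝ) L s
    have h2 := hc.integral_hasStrictDerivAt 0 s |>.hasDerivAt
    convert! h1.clm_apply h2 using 1
    rw [linearResponse, integral_exp_sub_smul_apply L hw, ← mul_apply_eq_comp,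
      exp_smul_mul_exp_smul]
    simp [add_comm]
  rw [intervalIntegral.integral_eq_sub_of_hasDerivAt (fun s _ ↦ hder s)
    ((L.continuous.comp (continuous_linearResponse L hw)).intervalIntegrable _ _)]
  simp [linearResponse, integral_exp_sub_smul_apply L hw, add_comm]

/-- Variation of constants: a solution of `x = x₀ + ∫ L x + w` on the half-line is the sum of the
free evolution of `x₀` and the response to `w`. -/
lemma eq_exp_add_linearResponse (L : E →L[ℝ] E) {w x : ℝ → E} {x₀ : E} (hw : Continuous w)
    (hx : Continuous x) (h : ∀ t, 0 ≤ t → x t = x₀ + (∫ s in 0..t, L (x s)) + w t)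
    {t : ℝ} (ht : 0 ≤ t) :
    x t = NormedSpace.exp (t • L) x₀ + linearResponse L w t := by
  have hc : Continuous fun s : ℝ ↦ NormedSpace.exp ((-s) • L) (L (w s)) :=
    ((continuous_exp_smul L).comp continuous_neg).clm_apply (by fun_prop)
  -- The integrating factor is applied to `x₀ + ∫ L x = x - w`, since `x` itself need not be
  -- differentiable. In the derivative the terms in `L x` cancel and only `L w` remains.
  have hder (s : ℝ) (hs : s ∈ Set.uIcc 0 t) : HasDerivAt (fun t : ℝ ↦ NormedSpace.exp ((-t) • L)
      (x₀ + ∫ s in 0..t, L (x s))) (NormedSpace.exp ((-s) • L) (L (w s))) s := by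
    rw [Set.uIcc_of_le ht] at hs
    have h1 := hasDerivAt_exp_neg_smul L s
    have h2 := (L.continuous.comp hx).integral_hasStrictDerivAt 0 s |>.hasDerivAt.const_add x₀
    convert! h1.clm_apply h2 using 1
    simp only [Function.comp_apply]
    rw [h s hs.1]
    simp
    abel
  have hftc := intervalIntegral.integral_eq_sub_of_hasDerivAt hder (hc.intervalIntegrable _ _)
  rw [linearResponse, integral_exp_sub_smul_apply L hw, hftc, map_sub,
    ← mul_apply_eq_comp, exp_smul_mul_exp_smul, h t ht]
  simp
  abel

end LinearODE

/-! ### Almost sure limits of centered Gaussian variables and processes -/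

section GaussianLimits

variable {Ω : Type*} {mΩ : MeasurableSpace Ω} {P : Measure Ω}

lemma tendsto_charFun_map_of_ae_tendsto {E : Type*} [NormedAddCommGroup E]
    [InnerProductSpace ℝ E] [MeasurableSpace E] [BorelSpace E] [SecondCountableTopology E]
    [IsFiniteMeasure P] {X : ℕ → Ω → E} {Y : Ω → E} (hX : ∀ n, AEMeasurable (X n) P)
    (hY : AEMeasurable Y P) (h : ∀ᵐ ω ∂P, Tendsto (fun n ↦ X n ω) atTop (𝓝 (Y ω))) (u : E) :
    Tendsto (fun n ↦ charFun (P.map (X n)) u) atTop (𝓝 (charFun (P.map Y) u)) := by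
  have heq (Z : Ω → E) (hZ : AEMeasurable Z P) : charFun (P.map Z) u =
      ∫ ω, Complex.exp (inner ℝ (Z ω) u * Complex.I) ∂P := by
    rw [charFun_apply, integral_map hZ (by fun_prop)]
  simp_rw [heq _ (hX _), heq _ hY]
  refine tendsto_integral_of_dominated_convergence (fun _ ↦ 1) (fun n ↦ ?_)
    (integrable_const _) (fun n ↦ ?_) ?_
  · have := hX n
    exact AEMeasurable.aestronglyMeasurable (by fun_prop)
  · simp [Complex.norm_exp_ofReal_mul_I]
  · filter_upwards [h] with ω hω
    have hc : Continuous fun x : E ↦ Complex.exp (inner ℝ x u * Complex.I) := by fun_prop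
    exact (hc.tendsto _).comp hω

/-- An almost sure limit of centered Gaussian variables is Gaussian, and the variances converge. -/
lemma exists_hasLaw_gaussianReal_of_ae_tendsto [IsProbabilityMeasure P] {X : ℕ → Ω → ℝ}
    {Y : Ω → ℝ} {v : ℕ → ℝ≥0} (hX : ∀ n, HasLaw (X n) (gaussianReal 0 (v n)) P)
    (h : ∀ᵐ ω ∂P, Tendsto (fun n ↦ X n ω) atTop (𝓝 (Y ω))) :
    ∃ w : ℝ≥0, Tendsto v atTop (𝓝 w) ∧ HasLaw Y (gaussianReal 0 w) P := by
  have hY : AEMeasurable Y P :=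
    aemeasurable_of_tendsto_metrizable_ae' (fun n ↦ (hX n).aemeasurable) h
  have : IsProbabilityMeasure (P.map Y) := Measure.isProbabilityMeasure_map hY
  have hlim := tendsto_charFun_map_of_ae_tendsto (fun n ↦ (hX n).aemeasurable) hY h
  simp_rw [(hX _).map_eq, charFun_gaussianReal] at hlim
  -- The modulus of the `n`-th characteristic function at `u` is `exp(-v_n u² / 2)`, so a logarithm
  -- recovers `v_n` wherever `u ≠ 0` and the limit is nonzero. Such `u` exist near `0` by
  -- continuity, the value at `0` being `1`.
  obtain ⟨u, hu, hφ⟩ : ∃ u : ℝ, u ≠ 0 ∧ charFun (P.map Y) u ≠ 0 := by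
    have hc : ContinuousAt (charFun (P.map Y)) 0 := continuous_charFun.continuousAt
    have hne : ∀ᶠ u in 𝓝 (0 : ℝ), charFun (P.map Y) u ≠ 0 := by
      refine hc.eventually_ne ?_
      simp
    obtain ⟨u, hu⟩ := ((hne.filter_mono nhdsWithin_le_nhds).and
      (self_mem_nhdsWithin (s := {0}ᶜ) (a := (0 : ℝ)))).exists
    exact ⟨u, hu.2, hu.1⟩
  have hnorm : Tendsto (fun n ↦ Real.exp (-(v n * u ^ 2 / 2))) atTop
      (𝓝 ‖charFun (P.map Y) u‖) := by
    refine (hlim u).norm.congr fun n ↦ ?_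
    rw [Complex.norm_exp]
    congr 1
    simp [← Complex.ofReal_pow]
  have hlog := (Real.continuousAt_log (norm_ne_zero_iff.2 hφ)).tendsto.comp hnorm
  have hv : Tendsto (fun n ↦ (v n : ℝ)) atTop
      (𝓝 (-(2 / u ^ 2) * Real.log ‖charFun (P.map Y) u‖)) := by
    refine (hlog.const_mul (-(2 / u ^ 2))).congr fun n ↦ ?_
    simp only [Function.comp_apply, Real.log_exp]
    field_simp
  lift -(2 / u ^ 2) * Real.log ‖charFun (P.map Y) u‖ to ℝ≥0 using
    ge_of_tendsto' hv fun n ↦ (v n).2 with w hw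
  refine ⟨w, NNReal.tendsto_coe.1 hv, hY, Measure.ext_of_charFun (funext fun r ↦ ?_)⟩
  refine tendsto_nhds_unique (hlim r) ?_
  rw [charFun_gaussianReal]
  have hc : Continuous fun x : ℝ ↦ Complex.exp (r * (0 : ℝ) * Complex.I - x * r ^ 2 / 2) := by
    fun_prop
  exact (hc.tendsto _).comp hv

/-- The law of a centered real Gaussian variable. -/
lemma ProbabilityTheory.HasGaussianLaw.hasLaw_gaussianReal_zero {X : Ω → ℝ}
    (hX : HasGaussianLaw X P) (h0 : P[X] = 0) :
    HasLaw X (gaussianReal 0 (Var[X; P]).toNNReal) P :=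
  ⟨hX.aemeasurable, by rw [hX.map_eq_gaussianReal, h0]⟩

/-- An almost sure limit of centered real Gaussian variables is centered Gaussian. -/
lemma hasGaussianLaw_of_ae_tendsto [IsProbabilityMeasure P] {X : ℕ → Ω → ℝ} {Y : Ω → ℝ}
    (hX : ∀ n, HasGaussianLaw (X n) P) (h0 : ∀ n, P[X n] = 0)
    (h : ∀ᵐ ω ∂P, Tendsto (fun n ↦ X n ω) atTop (𝓝 (Y ω))) :
    HasGaussianLaw Y P ∧ P[Y] = 0 := by
  obtain ⟨w, -, hw⟩ := exists_hasLaw_gaussianReal_of_ae_tendsto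
    (fun n ↦ (hX n).hasLaw_gaussianReal_zero (h0 n)) h
  exact ⟨hw.hasGaussianLaw, by rw [hw.integral_eq, integral_id_gaussianReal]⟩

/-- Centered Gaussian variables that converge almost surely converge in `L²`. -/
lemma tendsto_eLpNorm_sub_of_ae_tendsto [IsProbabilityMeasure P] {X : ℕ → Ω → ℝ} {Y : Ω → ℝ}
    (hX : ∀ n m, HasGaussianLaw (fun ω ↦ X n ω - X m ω) P)
    (h0 : ∀ n m, ∫ ω, (X n ω - X m ω) ∂P = 0)
    (h : ∀ᵐ ω ∂P, Tendsto (fun n ↦ X n ω) atTop (𝓝 (Y ω))) :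
    Tendsto (fun n ↦ eLpNorm (fun ω ↦ X n ω - Y ω) 2 P) atTop (𝓝 0) := by
  -- For fixed `n`, `X n - Y` is the limit of `X n - X m` as `m` grows.
  have hD (n : ℕ) : HasGaussianLaw (fun ω ↦ X n ω - Y ω) P ∧ ∫ ω, (X n ω - Y ω) ∂P = 0 :=
    hasGaussianLaw_of_ae_tendsto (hX n) (h0 n) (h.mono fun ω hω ↦ hω.const_sub _)
  have hlaw (n : ℕ) := (hD n).1.hasLaw_gaussianReal_zero (hD n).2
  -- The differences tend almost surely to the constant `0`, so their variances converge to its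
  -- variance, which is `0`.
  obtain ⟨w, hw, hw'⟩ := exists_hasLaw_gaussianReal_of_ae_tendsto hlaw
    (Y := fun _ ↦ 0) (h.mono fun ω hω ↦ by simpa using hω.sub_const (Y ω))
  have hw0 : w = 0 := by
    have := hw'.variance_eq
    rw [variance_id_gaussianReal, show (fun _ : Ω ↦ (0 : ℝ)) = 0 from rfl, variance_zero] at this
    simpa using this.symm
  have hnorm (n : ℕ) : eLpNorm (fun ω ↦ X n ω - Y ω) 2 P =
      ENNReal.ofReal (√(Var[fun ω ↦ X n ω - Y ω; P])) := by
    have hL2 : MemLp (fun ω ↦ X n ω - Y ω) 2 P := (hD n).1.memLp_two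
    rw [variance_of_integral_eq_zero hL2.aestronglyMeasurable.aemeasurable (hD n).2,
      hL2.eLpNorm_eq_integral_rpow_norm (by norm_num) (by norm_num), Real.sqrt_eq_rpow]
    simp
  simp_rw [hnorm]
  rw [hw0] at hw
  have h1 : Tendsto (fun n ↦ ENNReal.ofReal √(((Var[fun ω ↦ X n ω - Y ω; P]).toNNReal : ℝ≥0)))
      atTop (𝓝 (ENNReal.ofReal √((0 : ℝ≥0) : ℝ))) :=
    (ENNReal.continuous_ofReal.tendsto _).comp <| (Real.continuous_sqrt.tendsto _).comp
      (NNReal.tendsto_coe.2 hw)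
  simpa [variance_nonneg] using h1

/-- A pointwise almost sure limit of centered Gaussian processes is a centered Gaussian process. -/
lemma isGaussianProcess_of_ae_tendsto {T E : Type*} [NormedAddCommGroup E] [NormedSpace ℝ E]
    [MeasurableSpace E] [BorelSpace E] [SecondCountableTopology E] [CompleteSpace E]
    [IsProbabilityMeasure P] {X : ℕ → T → Ω → E} {Y : T → Ω → E}
    (hX : ∀ n, IsGaussianProcess (X n) P) (h0 : ∀ n t, P[X n t] = 0)
    (h : ∀ t, ∀ᵐ ω ∂P, Tendsto (fun n ↦ X n t ω) atTop (𝓝 (Y t ω))) :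
    IsGaussianProcess Y P where
  hasGaussianLaw I := by
    have hY (t : T) : AEMeasurable (Y t) P :=
      aemeasurable_of_tendsto_metrizable_ae' (fun n ↦ (hX n).aemeasurable t) (h t)
    have hYI : AEMeasurable (fun ω ↦ I.restrict (Y · ω)) P :=
      aemeasurable_pi_lambda _ fun i ↦ hY i
    have hlim : ∀ᵐ ω ∂P, Tendsto (fun n ↦ I.restrict (X n · ω)) atTop
        (𝓝 (I.restrict (Y · ω))) := by
      have : ∀ᵐ ω ∂P, ∀ i : I, Tendsto (fun n ↦ X n i ω) atTop (𝓝 (Y i ω)) :=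
        ae_all_iff.2 fun i ↦ h i
      filter_upwards [this] with ω hω using tendsto_pi_nhds.2 hω
    refine ⟨isGaussian_of_map_eq_gaussianReal fun L ↦ ?_⟩
    have hint (n : ℕ) : ∫ ω, L (I.restrict (X n · ω)) ∂P = 0 := by
      rw [L.integral_comp_comm ((hX n).hasGaussianLaw I).integrable]
      have : ∫ ω, I.restrict (X n · ω) ∂P = 0 := by
        ext i
        rw [eval_integral (f := fun ω ↦ I.restrict (X n · ω))
          fun j : I ↦ ((hX n).hasGaussianLaw_eval j).integrable]
        exact h0 n i
      rw [this, map_zero]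
    obtain ⟨hG, -⟩ := hasGaussianLaw_of_ae_tendsto (P := P)
      (X := fun n ω ↦ L (I.restrict (X n · ω))) (Y := fun ω ↦ L (I.restrict (Y · ω)))
      (fun n ↦ ((hX n).hasGaussianLaw I).map L) hint
      (hlim.mono fun ω hω ↦ (L.continuous.tendsto _).comp hω)
    exact ⟨_, _, (AEMeasurable.map_map_of_aemeasurable L.continuous.measurable.aemeasurable
      hYI).trans hG.map_eq_gaussianReal⟩

end GaussianLimits

/-! ### Matrix exponentials in coordinates -/

section MatrixExponential

variable {d : ℕ} (A : Matrix (Fin d) (Fin d) ℝ)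

lemma Matrix.toEuclideanCLM_apply_apply (M : Matrix (Fin d) (Fin d) ℝ)
    (x : EuclideanSpace ℝ (Fin d)) (i : Fin d) :
    Matrix.toEuclideanCLM (𝕜 := ℝ) M x i = ∑ j, M i j * x j := by
  simp [Matrix.mulVec, dotProduct]

/-- The inverse of `toEuclideanCLM` is an algebra map, continuous by finite dimensionality, so the
exponential series can be pulled back term by term. This transfers the calculus of operator
exponentials to matrices. -/
lemma Matrix.toEuclideanCLM_exp_smul (r : ℝ) :
    Matrix.toEuclideanCLM (𝕜 := ℝ) (NormedSpace.exp (r • A)) =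
      NormedSpace.exp (r • Matrix.toEuclideanCLM (𝕜 := ℝ) A) := by
  have hc : Continuous (Matrix.toEuclideanCLM (n := Fin d) (𝕜 := ℝ)).symm :=
    (Matrix.toEuclideanCLM (n := Fin d) (𝕜 := ℝ)).symm.toAlgEquiv.toLinearMap
      |>.continuous_of_finiteDimensional
  have h := (NormedSpace.exp_series_hasSum_exp' (𝕂 := ℝ)
    (r • Matrix.toEuclideanCLM (𝕜 := ℝ) A)).map
    (Matrix.toEuclideanCLM (n := Fin d) (𝕜 := ℝ)).symm hc
  rw [← StarAlgEquiv.apply_symm_apply (Matrix.toEuclideanCLM (n := Fin d) (𝕜 := ℝ))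
    (NormedSpace.exp (r • Matrix.toEuclideanCLM (𝕜 := ℝ) A)), ← h.tsum_eq,
    NormedSpace.exp_eq_tsum ℝ]
  simp

lemma Matrix.hasDerivAt_exp_const_sub_smul_apply (t s : ℝ) (i j : Fin d) :
    HasDerivAt (fun s : ℝ ↦ NormedSpace.exp ((t - s) • A) i j)
      (-(NormedSpace.exp ((t - s) • A) * A) i j) s := by
  have hent (M : Matrix (Fin d) (Fin d) ℝ) : M i j =
      EuclideanSpace.proj (𝕜 := ℝ) i
        (Matrix.toEuclideanCLM (𝕜 := ℝ) M (EuclideanSpace.single j 1)) := by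
    simp
  have h := ((hasDerivAt_exp_const_sub_smul (Matrix.toEuclideanCLM (𝕜 := ℝ) A) t s).clm_apply
    (hasDerivAt_const s (EuclideanSpace.single j (1 : ℝ))))
  have h2 := (EuclideanSpace.proj (𝕜 := ℝ) i).hasFDerivAt.comp_hasDerivAt s h
  simp only [← Matrix.toEuclideanCLM_exp_smul, ← map_mul] at h2
  simp_rw [hent]
  convert! h2 using 1
  simp

lemma Matrix.continuous_exp_smul_apply (i j : Fin d) :
    Continuous fun s : ℝ ↦ NormedSpace.exp (s • A) i j := by
  have h : Continuous fun s : ℝ ↦ NormedSpace.exp ((0 - s) • A) i j :=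
    continuous_iff_continuousAt.2
      fun s ↦ (Matrix.hasDerivAt_exp_const_sub_smul_apply A 0 s i j).continuousAt
  simpa [Function.comp_def] using h.comp continuous_neg

lemma Matrix.continuous_exp_smul : Continuous fun s : ℝ ↦ NormedSpace.exp (s • A) :=
  continuous_matrix fun i j ↦ Matrix.continuous_exp_smul_apply A i j

lemma Matrix.continuous_exp_const_sub_smul_mul_apply (t : ℝ) (i j : Fin d) :
    Continuous fun s : ℝ ↦ (NormedSpace.exp ((t - s) • A) * A) i j := by
  simp only [Matrix.mul_apply]
  exact continuous_finsetSum _ fun k _ ↦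
    ((Matrix.continuous_exp_smul_apply A i k).comp (continuous_const.sub continuous_id)).mul
      continuous_const

/-- The response of a linear system in coordinates, after integration by parts. -/
lemma linearResponse_toEuclideanCLM_apply {w : ℝ → EuclideanSpace ℝ (Fin d)} (hw : Continuous w)
    (t : ℝ) (i : Fin d) :
    linearResponse (Matrix.toEuclideanCLM (𝕜 := ℝ) A) w t i =
      ∑ j, (NormedSpace.exp ((t - t) • A) i j * w t j -
        ∫ s in 0..t, -(NormedSpace.exp ((t - s) • A) * A) i j * w s j) := by
  have hwj (j : Fin d) : Continuous fun s ↦ w s j := by fun_prop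
  have hcont : Continuous fun s : ℝ ↦
      Matrix.toEuclideanCLM (𝕜 := ℝ) (NormedSpace.exp ((t - s) • A) * A) (w s) := by
    have hi : Continuous fun (s : ℝ) (i : Fin d) ↦
        Matrix.toEuclideanCLM (𝕜 := ℝ) (NormedSpace.exp ((t - s) • A) * A) (w s) i := by
      refine continuous_pi fun i ↦ ?_
      simp_rw [Matrix.toEuclideanCLM_apply_apply]
      exact continuous_finsetSum _ fun j _ ↦
        (Matrix.continuous_exp_const_sub_smul_mul_apply A t i j).mul (hwj j)
    exact (PiLp.continuous_toLp 2 _).comp hi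
  have hint : ∫ s in 0..t, NormedSpace.exp ((t - s) • Matrix.toEuclideanCLM (𝕜 := ℝ) A)
      (Matrix.toEuclideanCLM (𝕜 := ℝ) A (w s)) = ∫ s in 0..t,
        Matrix.toEuclideanCLM (𝕜 := ℝ) (NormedSpace.exp ((t - s) • A) * A) (w s) := by
    congr! 2 with s
    rw [map_mul, Matrix.toEuclideanCLM_exp_smul, mul_apply_eq_comp]
  have hproj := (EuclideanSpace.proj (𝕜 := ℝ) i).intervalIntegral_comp_comm
    (hcont.intervalIntegrable (μ := volume) 0 t)
  simp only [PiLp.proj_apply] at hproj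
  rw [linearResponse, PiLp.add_apply, hint, ← hproj]
  simp_rw [Matrix.toEuclideanCLM_apply_apply]
  rw [intervalIntegral.integral_finsetSum]
  · simp [Finset.sum_add_distrib, Matrix.one_apply]
  · exact fun j _ ↦ ((Matrix.continuous_exp_const_sub_smul_mul_apply A t i j).mul
      (hwj j)).intervalIntegrable _ _

lemma tendsto_sum_exp_apply {w : ℝ → EuclideanSpace ℝ (Fin d)} (hw : Continuous w)
    (hw0 : w 0 = 0) {t : ℝ} (ht : 0 ≤ t) :
    Tendsto (fun n ↦ ∑ k ∈ Finset.range (n + 1),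
      Matrix.toEuclideanCLM (𝕜 := ℝ) (NormedSpace.exp ((t - uniformGrid t n k) • A))
        (w (uniformGrid t n (k + 1)) - w (uniformGrid t n k))) atTop
      (𝓝 (linearResponse (Matrix.toEuclideanCLM (𝕜 := ℝ) A) w t)) := by
  have hwj (j : Fin d) : Continuous fun s ↦ w s j := by fun_prop
  have hcoord : Tendsto (fun n i ↦ (∑ k ∈ Finset.range (n + 1),
      Matrix.toEuclideanCLM (𝕜 := ℝ) (NormedSpace.exp ((t - uniformGrid t n k) • A))
        (w (uniformGrid t n (k + 1)) - w (uniformGrid t n k))) i) atTop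
      (𝓝 fun i ↦ linearResponse (Matrix.toEuclideanCLM (𝕜 := ℝ) A) w t i) := by
    refine tendsto_pi_nhds.2 fun i ↦ ?_
    rw [linearResponse_toEuclideanCLM_apply A hw]
    have h := tendsto_finsetSum (Finset.univ : Finset (Fin d)) fun j _ ↦
      tendsto_stieltjes_sum_uniformGrid
        (fun s ↦ Matrix.hasDerivAt_exp_const_sub_smul_apply A t s i j)
        (Matrix.continuous_exp_const_sub_smul_mul_apply A t i j).neg (hwj j)
        (by simp [hw0]) ht
    refine h.congr fun n ↦ ?_
    rw [Finset.sum_comm]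
    simp only [WithLp.ofLp_sum, Finset.sum_apply, Matrix.toEuclideanCLM_apply_apply,
      PiLp.sub_apply]
  exact ((PiLp.continuous_toLp 2 _).tendsto _).comp hcoord

end MatrixExponential

/-! ### The quadratic form of the covariance matrix -/

section QuadraticForm

variable {d : ℕ} (A : Matrix (Fin d) (Fin d) ℝ)

lemma Matrix.inner_toEuclideanCLM_left (M : Matrix (Fin d) (Fin d) ℝ)
    (x y : EuclideanSpace ℝ (Fin d)) :
    inner ℝ (Matrix.toEuclideanCLM (𝕜 := ℝ) M x) y =
      inner ℝ x (Matrix.toEuclideanCLM (𝕜 := ℝ) Mᵀ y) := by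
  rw [real_inner_comm, Matrix.inner_toEuclideanCLM, Matrix.inner_toEuclideanCLM,
    Matrix.mulVec_transpose, Matrix.dotProduct_mulVec, dotProduct_comm]

lemma Matrix.norm_sq_toEuclideanCLM_transpose (M : Matrix (Fin d) (Fin d) ℝ)
    (x : EuclideanSpace ℝ (Fin d)) :
    ‖Matrix.toEuclideanCLM (𝕜 := ℝ) Mᵀ x‖ ^ 2 = x ⬝ᵥ (M * Mᵀ) *ᵥ x := by
  rw [← real_inner_self_eq_norm_sq, Matrix.inner_toEuclideanCLM_left, Matrix.transpose_transpose,
    ← mul_apply_eq_comp, ← map_mul, Matrix.inner_toEuclideanCLM]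

lemma Matrix.continuous_exp_mul_transpose_apply (t : ℝ) (i j : Fin d) :
    Continuous fun s : ℝ ↦
      (NormedSpace.exp ((t - s) • A) * (NormedSpace.exp ((t - s) • A))ᵀ) i j := by
  have hc : Continuous fun s : ℝ ↦ NormedSpace.exp ((t - s) • A) :=
    (Matrix.continuous_exp_smul A).comp (continuous_const.sub continuous_id)
  exact (hc.matrix_mul hc.matrix_transpose).matrix_elem i j

namespace LocalGlobal

lemma dotProduct_covMatrix_mulVec (γ : ℝ) (t : ℝ≥0) (x : EuclideanSpace ℝ (Fin d)) :
    x ⬝ᵥ covMatrix A γ t *ᵥ x = γ ^ 2 * ∫ s in (0 : ℝ)..t,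
      ‖Matrix.toEuclideanCLM (𝕜 := ℝ) (NormedSpace.exp (((t : ℝ) - s) • A))ᵀ x‖ ^ 2 := by
  simp_rw [Matrix.norm_sq_toEuclideanCLM_transpose, dotProduct, Matrix.mulVec, dotProduct]
  have hc (i j : Fin d) := Matrix.continuous_exp_mul_transpose_apply A t i j
  have hint (i j : Fin d) : IntervalIntegrable (fun s : ℝ ↦
      (NormedSpace.exp (((t : ℝ) - s) • A) * (NormedSpace.exp (((t : ℝ) - s) • A))ᵀ) i j * x j)
      volume 0 t := ((hc i j).mul continuous_const).intervalIntegrable _ _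
  rw [intervalIntegral.integral_finsetSum fun i _ ↦ ?_, Finset.mul_sum]
  · refine Finset.sum_congr rfl fun i _ ↦ ?_
    rw [intervalIntegral.integral_const_mul, intervalIntegral.integral_finsetSum fun j _ ↦ hint i j,
      mul_left_comm]
    congr 1
    rw [Finset.mul_sum]
    refine Finset.sum_congr rfl fun j _ ↦ ?_
    rw [intervalIntegral.integral_mul_const, covMatrix, Matrix.of_apply, mul_assoc]
  · refine IntervalIntegrable.const_mul ?_ _
    simpa only [Finset.sum_fn] using IntervalIntegrable.sum Finset.univ fun j _ ↦ hint i j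

lemma covMatrix_isHermitian (γ : ℝ) (t : ℝ≥0) : (covMatrix A γ t).IsHermitian := by
  ext i j
  simp only [covMatrix, Matrix.conjTranspose_apply, Matrix.of_apply, star_trivial]
  congr 2
  ext s
  simp only [Matrix.mul_apply, Matrix.transpose_apply, mul_comm]

lemma covMatrix_posSemidef (γ : ℝ) (t : ℝ≥0) : (covMatrix A γ t).PosSemidef := by
  refine Matrix.PosSemidef.of_dotProduct_mulVec_nonneg (covMatrix_isHermitian A γ t) fun x ↦ ?_
  have := dotProduct_covMatrix_mulVec A γ t (WithLp.toLp 2 x)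
  rw [star_trivial, show x ⬝ᵥ covMatrix A γ t *ᵥ x = _ from this]
  exact mul_nonneg (sq_nonneg _)
    (intervalIntegral.integral_nonneg t.2 fun _ _ ↦ sq_nonneg _)

lemma continuous_norm_sq_exp_transpose (t : ℝ) (x : EuclideanSpace ℝ (Fin d)) :
    Continuous fun s : ℝ ↦
      ‖Matrix.toEuclideanCLM (𝕜 := ℝ) (NormedSpace.exp ((t - s) • A))ᵀ x‖ ^ 2 := by
  simp_rw [Matrix.norm_sq_toEuclideanCLM_transpose, dotProduct, Matrix.mulVec, dotProduct]
  exact continuous_finsetSum _ fun i _ ↦ continuous_const.mul <| continuous_finsetSum _ fun j _ ↦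
    (Matrix.continuous_exp_mul_transpose_apply A t i j).mul continuous_const

/-- The quadratic form integrates `‖exp(A(t-s))ᵀ x‖²`, which is positive for every `s` because the
exponential is invertible. -/
lemma covMatrix_posDef {γ : ℝ} (hγ : γ ≠ 0) {t : ℝ≥0} (ht : 0 < t) :
    (covMatrix A γ t).PosDef := by
  refine Matrix.PosDef.of_dotProduct_mulVec_pos (covMatrix_isHermitian A γ t) fun x hx ↦ ?_
  have := dotProduct_covMatrix_mulVec A γ t (WithLp.toLp 2 x)
  rw [star_trivial, show x ⬝ᵥ covMatrix A γ t *ᵥ x = _ from this]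
  refine mul_pos (by positivity) (intervalIntegral.intervalIntegral_pos_of_pos
    ((continuous_norm_sq_exp_transpose A t _).intervalIntegrable _ _) (fun s ↦ ?_) ht)
  have hu : IsUnit (NormedSpace.exp (((t : ℝ) - s) • A))ᵀ :=
    (Matrix.isUnit_exp _).map (Matrix.transposeAlgEquiv (Fin d) ℝ ℝ).toAlgHom |>.unop
  have hne : Matrix.toEuclideanCLM (𝕜 := ℝ) (NormedSpace.exp (((t : ℝ) - s) • A))ᵀ
      (WithLp.toLp 2 x) ≠ 0 := by
    rw [Matrix.toEuclideanCLM_toLp]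
    intro h0
    refine hx (Matrix.mulVec_injective_of_isUnit hu ?_)
    simpa using h0
  positivity

end LocalGlobal

end QuadraticForm

/-! ### Increments of Brownian motion -/

namespace LocalGlobal

namespace IsBrownianMotion

variable {Ω : Type*} {mΩ : MeasurableSpace Ω} {d : ℕ} {P : Measure Ω} {ℱ : Filtration ℝ≥0 mΩ}
  {W : ℝ≥0 → Ω → EuclideanSpace ℝ (Fin d)}

lemma ae_continuous (hW : IsBrownianMotion W ℱ P) : ∀ᵐ ω ∂P, Continuous fun t ↦ W t ω := by
  have h : ∀ᵐ ω ∂P, ∀ i, Continuous fun t ↦ W t ω i := ae_all_iff.2 fun i ↦ (hW.coord i).cont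
  filter_upwards [h] with ω hω
  exact (PiLp.continuous_toLp 2 _).comp (continuous_pi hω)

lemma ae_eval_zero (hW : IsBrownianMotion W ℱ P) : ∀ᵐ ω ∂P, W 0 ω = 0 := by
  have h : ∀ᵐ ω ∂P, ∀ i, W 0 ω i = 0 := ae_all_iff.2 fun i ↦ (hW.coord i).eval_zero_ae_eq_zero
  filter_upwards [h] with ω hω
  ext i
  simpa using hω i

lemma measurable (hW : IsBrownianMotion W ℱ P) (t : ℝ≥0) : Measurable (W t) :=
  ((hW.adapted t).mono (ℱ.le t)).measurable

/-- Independent Gaussian families are jointly Gaussian; `K` regroups them from coordinates-by-times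
to times-by-coordinates. -/
lemma isGaussianProcess (hW : IsBrownianMotion W ℱ P) : IsGaussianProcess W P where
  hasGaussianLaw I := by
    have hind : iIndepFun (fun i ω ↦ I.restrict fun t ↦ W t ω i) P :=
      hW.indep_coord.comp (fun _ g ↦ I.restrict g) fun _ ↦ Finset.measurable_restrict I
    have h := iIndepFun.hasGaussianLaw
      (fun i ↦ IsGaussianProcess.hasGaussianLaw
        (IsPreBrownianReal.isGaussianProcess (hW.coord i).toIsPreBrownianReal) I) hind
    let K : (Fin d → I → ℝ) →L[ℝ] I → EuclideanSpace ℝ (Fin d) :=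
      { toFun x t := WithLp.toLp 2 fun i ↦ x i t
        map_add' x y := by ext; simp
        map_smul' c x := by ext; simp }
    exact h.map K

lemma integral_eval (hW : IsBrownianMotion W ℱ P) (t : ℝ≥0) : ∫ ω, W t ω ∂P = 0 := by
  have hint := (hW.isGaussianProcess.hasGaussianLaw_eval t).integrable
  ext i
  have := (EuclideanSpace.proj (𝕜 := ℝ) i).integral_comp_comm hint
  simp only [PiLp.proj_apply] at this
  rw [← this, PiLp.zero_apply]
  exact (hW.coord i).integral_eval t

lemma charFun_map_sub (hW : IsBrownianMotion W ℱ P) [IsProbabilityMeasure P] {s t : ℝ≥0}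
    (hst : s ≤ t) (c : EuclideanSpace ℝ (Fin d)) :
    charFun (P.map fun ω ↦ W t ω - W s ω) c =
      Complex.exp (-(((t : ℝ) - s) * ‖c‖ ^ 2 / 2 : ℝ)) := by
  have hm (i : Fin d) : Measurable fun ω ↦ W t ω i - W s ω i := by
    have := hW.measurable t
    have := hW.measurable s
    fun_prop
  have hind : iIndepFun (fun i ω ↦ W t ω i - W s ω i) P :=
    hW.indep_coord.comp (fun _ g ↦ g t - g s) fun _ ↦ by fun_prop
  have hlaw (i : Fin d) : P.map (fun ω ↦ W t ω i - W s ω i) = gaussianReal 0 (t - s) := by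
    have hnn : nndist (t : ℝ) s = t - s := by
      rw [← NNReal.coe_inj, NNReal.coe_sub hst, coe_nndist, Real.dist_eq, abs_of_nonneg]
      simpa using hst
    rw [← hnn]
    exact ((hW.coord i).hasLaw_sub t s).map_eq
  have hpi := (iIndepFun_iff_map_fun_eq_pi_map fun i ↦ (hm i).aemeasurable).1 hind
  have hmap : P.map (fun ω ↦ W t ω - W s ω) =
      (Measure.pi fun _ : Fin d ↦ gaussianReal 0 (t - s)).map (WithLp.toLp 2) := by
    simp only [hlaw] at hpi
    rw [← hpi, Measure.map_map (by fun_prop) (measurable_pi_lambda _ hm)]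
    rfl
  rw [hmap, charFun_pi]
  simp_rw [charFun_gaussianReal, EuclideanSpace.real_norm_sq_eq, ← Complex.exp_sum]
  congr 1
  push_cast [NNReal.coe_sub hst]
  simp [Finset.mul_sum, Finset.sum_div]

/-- The increments after time `s` are independent of `ℱ s`, in terms of characteristic
functions. -/
lemma setIntegral_exp_sum (hW : IsBrownianMotion W ℱ P) [IsProbabilityMeasure P] {s : ℝ≥0}
    {F : Set Ω} (hF : MeasurableSet[ℱ s] F) {τ : ℕ → ℝ≥0} (hτ : Monotone τ) (hs : s ≤ τ 0)
    (c : ℕ → EuclideanSpace ℝ (Fin d)) (m : ℕ) :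
    ∫ ω in F, Complex.exp ((∑ k ∈ Finset.range m, inner ℝ (W (τ (k + 1)) ω - W (τ k) ω) (c k) : ℝ)
        * Complex.I) ∂P =
      P.real F * Complex.exp
        (-(∑ k ∈ Finset.range m, ((τ (k + 1) : ℝ) - τ k) * ‖c k‖ ^ 2 / 2 : ℝ)) := by
  induction m with
  | zero => simp [Measure.real]
  | succ m ih =>
    -- `Y` is `ℱ (τ m)`-measurable, including the indicator of `F` because `s ≤ τ 0`, while `V`
    -- depends only on the next increment. The expectation of the product therefore splits off one
    -- factor.
    set Y : Ω → ℂ := F.indicator fun ω ↦ Complex.exp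
      ((∑ k ∈ Finset.range m, inner ℝ (W (τ (k + 1)) ω - W (τ k) ω) (c k) : ℝ) * Complex.I) with hY
    set V : Ω → ℂ := fun ω ↦
      Complex.exp ((inner ℝ (W (τ (m + 1)) ω - W (τ m) ω) (c m) : ℝ) * Complex.I) with hV
    have hYm : Measurable[ℱ (τ m)] Y := by
      refine Measurable.indicator ?_ (ℱ.mono (hs.trans (hτ (Nat.zero_le m))) _ hF)
      have hmeas (k : ℕ) (hk : k ≤ m) : Measurable[ℱ (τ m)] (W (τ k)) :=
        ((hW.adapted (τ k)).mono (ℱ.mono (hτ hk))).measurable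
      have hsum : Measurable[ℱ (τ m)] fun ω ↦
          ∑ k ∈ Finset.range m, inner ℝ (W (τ (k + 1)) ω - W (τ k) ω) (c k) := by
        refine Finset.measurable_sum _ fun k hk ↦ ?_
        have hk := Finset.mem_range.1 hk
        have h1 := hmeas k hk.le
        have h2 := hmeas (k + 1) hk
        exact (h2.sub h1).inner measurable_const
      exact Complex.measurable_exp.comp ((Complex.measurable_ofReal.comp hsum).mul_const _)
    have hVm : Measurable[MeasurableSpace.comap (fun ω ↦ W (τ (m + 1)) ω - W (τ m) ω)
        inferInstance] V := by
      have hg : Measurable fun x : EuclideanSpace ℝ (Fin d) ↦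
          Complex.exp ((inner ℝ x (c m) : ℝ) * Complex.I) := by fun_prop
      exact hg.comp (comap_measurable _)
    have hind : IndepFun Y V P := by
      refine indep_of_indep_of_le_left (indep_of_indep_of_le_right
        (hW.indep_increment _ _ (hτ (Nat.le_succ m))).symm ?_) ?_
      · exact hVm.comap_le
      · exact hYm.comap_le
    have hinc : Measurable fun ω ↦ W (τ (m + 1)) ω - W (τ m) ω :=
      (hW.measurable _).sub (hW.measurable _)
    have hVm' : Measurable V := hVm.mono hinc.comap_le le_rfl
    have hVint : ∫ ω, V ω ∂P =
        Complex.exp (-(((τ (m + 1) : ℝ) - τ m) * ‖c m‖ ^ 2 / 2 : ℝ)) := by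
      rw [← hW.charFun_map_sub (hτ (Nat.le_succ m)), charFun_apply,
        integral_map hinc.aemeasurable (by fun_prop)]
    have hFm : MeasurableSet F := ℱ.le s _ hF
    have hmul := hind.integral_fun_mul_eq_mul_integral
      (hYm.mono (ℱ.le _) le_rfl).aestronglyMeasurable hVm'.aestronglyMeasurable
    rw [hY, integral_indicator hFm, ih, hVint] at hmul
    rw [Finset.sum_range_succ]
    push_cast [neg_add, Complex.exp_add] at hmul ⊢
    rw [← mul_assoc, ← hmul, ← integral_indicator hFm]
    refine integral_congr_ae (ae_of_all _ fun ω ↦ ?_)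
    by_cases hω : ω ∈ F
    · simp [hω, V, Finset.sum_range_succ, add_mul, Complex.exp_add]
    · simp [hω]

end IsBrownianMotion

end LocalGlobal

/-! ### Linear combinations of increments -/

section IncrementSums

variable {Ω T E F : Type*} {mΩ : MeasurableSpace Ω} {P : Measure Ω} [NormedAddCommGroup E]
  [NormedSpace ℝ E] [MeasurableSpace E] [BorelSpace E] [SecondCountableTopology E]
  [NormedAddCommGroup F] [NormedSpace ℝ F] [MeasurableSpace F] [BorelSpace F]
  [SecondCountableTopology F]

/-- Linear combinations of increments of a Gaussian process form a Gaussian process. -/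
lemma ProbabilityTheory.IsGaussianProcess.sum_increments {X : T → Ω → E}
    (hX : IsGaussianProcess X P) {S : Type*} (m : S → ℕ) (τ : S → ℕ → T)
    (M : S → ℕ → E →L[ℝ] F) :
    IsGaussianProcess (fun s ω ↦ ∑ k ∈ Finset.range (m s),
      M s k (X (τ s (k + 1)) ω - X (τ s k) ω)) P := by
  classical
  refine hX.of_isGaussianProcess fun s ↦ ?_
  set I : Finset T := (Finset.range (m s + 1)).image (τ s) with hI
  -- Evaluation at `u`; the default `0` outside `I` is never used, since `I` contains all the nodes
  -- that occur.
  let π (u : T) : (I → E) →L[ℝ] E :=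
    if h : u ∈ I then ContinuousLinearMap.proj ⟨u, h⟩ else 0
  have hπ (k : ℕ) (hk : k ≤ m s) (f : T → E) : π (τ s k) (I.restrict f) = f (τ s k) := by
    have : τ s k ∈ I := Finset.mem_image_of_mem _ (Finset.mem_range.2 (by lia))
    simp [π, this]
  refine ⟨I, ∑ k ∈ Finset.range (m s), M s k ∘L (π (τ s (k + 1)) - π (τ s k)), fun ω ↦ ?_⟩
  rw [sum_apply]
  refine Finset.sum_congr rfl fun k hk ↦ ?_
  have hk := Finset.mem_range.1 hk
  simp [hπ k hk.le, hπ (k + 1) hk]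

end IncrementSums

lemma integral_sum_increments_eq_zero {Ω T E F : Type*} {mΩ : MeasurableSpace Ω}
    {P : Measure Ω} [NormedAddCommGroup E] [NormedSpace ℝ E] [CompleteSpace E]
    [NormedAddCommGroup F] [NormedSpace ℝ F] [CompleteSpace F] {X : T → Ω → E}
    (hX : ∀ t, Integrable (X t) P) (h0 : ∀ t, P[X t] = 0) (m : ℕ) (τ : ℕ → T) (M : ℕ → E →L[ℝ] F) :
    ∫ ω, ∑ k ∈ Finset.range m, M k (X (τ (k + 1)) ω - X (τ k) ω) ∂P = 0 := by
  have hint (k : ℕ) : Integrable (fun ω ↦ X (τ (k + 1)) ω - X (τ k) ω) P := (hX _).sub (hX _)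
  rw [integral_finsetSum _ fun k _ ↦ (M k).integrable_comp (hint k)]
  refine Finset.sum_eq_zero fun k _ ↦ ?_
  rw [(M k).integral_comp_comm (hint k), integral_sub (hX _) (hX _), h0, h0]
  simp

lemma linearResponse_smul {E : Type*} [NormedAddCommGroup E] [NormedSpace ℝ E]
    (L : E →L[ℝ] E) (w : ℝ → E) (c t : ℝ) :
    linearResponse L (fun s ↦ c • w s) t = c • linearResponse L w t := by
  simp [linearResponse, intervalIntegral.integral_smul]

/-! ### The noise accumulated after a time `s` -/

namespace LocalGlobal

variable {Ω : Type*} {mΩ : MeasurableSpace Ω} {d : ℕ} {P : Measure Ω} {ℱ : Filtration ℝ≥0 mΩ}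
  {W : ℝ≥0 → Ω → EuclideanSpace ℝ (Fin d)}

/-- The path of `W` after time `s`, relative to its position at time `s`. -/
def shiftedPath (W : ℝ≥0 → Ω → EuclideanSpace ℝ (Fin d)) (s : ℝ≥0) (ω : Ω) (x : ℝ) :
    EuclideanSpace ℝ (Fin d) :=
  W (s + x.toNNReal) ω - W s ω

/-- The noise accumulated over `[s, s + r]` by a linear system driven by `W`. -/
noncomputable def noise (A : Matrix (Fin d) (Fin d) ℝ) (W : ℝ≥0 → Ω → EuclideanSpace ℝ (Fin d))
    (s r : ℝ≥0) (ω : Ω) : EuclideanSpace ℝ (Fin d) :=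
  linearResponse (Matrix.toEuclideanCLM (𝕜 := ℝ) A) (shiftedPath W s ω) r

/-- The approximation of `∫_0^r exp(A (r - u)) dW_{s + u}` along a uniform partition. -/
noncomputable def noiseSum (A : Matrix (Fin d) (Fin d) ℝ)
    (W : ℝ≥0 → Ω → EuclideanSpace ℝ (Fin d)) (s r : ℝ≥0) (n : ℕ) (ω : Ω) :
    EuclideanSpace ℝ (Fin d) :=
  ∑ k ∈ Finset.range (n + 1),
    Matrix.toEuclideanCLM (𝕜 := ℝ) (NormedSpace.exp (((r : ℝ) - uniformGrid r n k) • A))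
      (W (s + (uniformGrid r n (k + 1)).toNNReal) ω - W (s + (uniformGrid r n k).toNNReal) ω)

lemma continuous_shiftedPath {ω : Ω} (h : Continuous fun t ↦ W t ω) (s : ℝ≥0) :
    Continuous (shiftedPath W s ω) := by
  unfold shiftedPath
  exact (h.comp (continuous_const.add continuous_real_toNNReal)).sub continuous_const

lemma tendsto_noiseSum (A : Matrix (Fin d) (Fin d) ℝ) {ω : Ω} (h : Continuous fun t ↦ W t ω)
    (s r : ℝ≥0) :
    Tendsto (fun n ↦ noiseSum A W s r n ω) atTop (𝓝 (noise A W s r ω)) := by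
  have := tendsto_sum_exp_apply A (continuous_shiftedPath h s) (by simp [shiftedPath]) r.2
  simpa [shiftedPath, noise, noiseSum] using this

namespace IsBrownianMotion

lemma measurable_noiseSum (hW : IsBrownianMotion W ℱ P) (A : Matrix (Fin d) (Fin d) ℝ)
    (s r : ℝ≥0) (n : ℕ) : Measurable (noiseSum A W s r n) := by
  have := hW.measurable
  unfold noiseSum
  fun_prop

lemma stronglyMeasurable_noiseSum (hW : IsBrownianMotion W ℱ P) (A : Matrix (Fin d) (Fin d) ℝ)
    (s r : ℝ≥0) (n : ℕ) : StronglyMeasurable[ℱ (s + r)] (noiseSum A W s r n) := by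
  have hm (k : ℕ) (hk : k ≤ n + 1) :
      StronglyMeasurable[ℱ (s + r)] (W (s + (uniformGrid r n k).toNNReal)) := by
    refine (hW.adapted _).mono (ℱ.mono ?_)
    gcongr
    exact Real.toNNReal_le_iff_le_coe.2 (uniformGrid.le_last r.2 hk)
  unfold noiseSum
  refine Finset.stronglyMeasurable_fun_sum _ fun k hk ↦ ?_
  have hk := Finset.mem_range.1 hk
  exact (ContinuousLinearMap.continuous _).comp_stronglyMeasurable
    ((hm (k + 1) hk).sub (hm k hk.le))

lemma aemeasurable_noise (hW : IsBrownianMotion W ℱ P) (A : Matrix (Fin d) (Fin d) ℝ)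
    (s r : ℝ≥0) : AEMeasurable (noise A W s r) P :=
  aemeasurable_of_tendsto_metrizable_ae' (fun n ↦ (hW.measurable_noiseSum A s r n).aemeasurable)
    (hW.ae_continuous.mono fun _ hω ↦ tendsto_noiseSum A hω s r)

variable [IsProbabilityMeasure P]

/-- Moving each exponential to the other side of the inner product reduces this to
`setIntegral_exp_sum` with weights `exp(A(r - u_k))ᵀ u`. -/
lemma charFun_map_restrict_noiseSum (hW : IsBrownianMotion W ℱ P)
    (A : Matrix (Fin d) (Fin d) ℝ) {s : ℝ≥0} (r : ℝ≥0) {F : Set Ω} (hF : MeasurableSet[ℱ s] F)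
    (n : ℕ) (u : EuclideanSpace ℝ (Fin d)) :
    charFun ((P.restrict F).map (noiseSum A W s r n)) u =
      P.real F * Complex.exp (-((∑ k ∈ Finset.range (n + 1),
        ‖Matrix.toEuclideanCLM (𝕜 := ℝ)
          (NormedSpace.exp (((r : ℝ) - uniformGrid r n k) • A))ᵀ u‖ ^ 2 *
        (uniformGrid r n (k + 1) - uniformGrid r n k)) / 2 : ℝ)) := by
  rw [charFun_apply, integral_map (hW.measurable_noiseSum A s r n).aemeasurable (by fun_prop)]
  have hmono : Monotone fun k ↦ s + (uniformGrid r n k).toNNReal := fun k l hkl ↦ by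
    dsimp only
    gcongr
    exact uniformGrid.mono r.2 hkl
  have h := hW.setIntegral_exp_sum hF hmono (by simp)
    (fun k ↦ Matrix.toEuclideanCLM (𝕜 := ℝ)
      (NormedSpace.exp (((r : ℝ) - uniformGrid r n k) • A))ᵀ u) (n + 1)
  have hg (k : ℕ) : 0 ≤ uniformGrid r n k := uniformGrid.nonneg r.2
  convert h using 4
  · simp only [noiseSum, sum_inner, Matrix.inner_toEuclideanCLM_left]
  · rw [Finset.sum_div]
    congr 1
    refine Finset.sum_congr rfl fun k _ ↦ ?_
    push_cast
    rw [Real.coe_toNNReal _ (hg _), Real.coe_toNNReal _ (hg _)]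
    ring

/-- The exponents for the sums are left Riemann sums of a continuous function. Keeping a general `F`
in `ℱ s` is what encodes independence from the past. -/
lemma charFun_map_restrict_noise (hW : IsBrownianMotion W ℱ P)
    (A : Matrix (Fin d) (Fin d) ℝ) {s : ℝ≥0} (r : ℝ≥0) {F : Set Ω} (hF : MeasurableSet[ℱ s] F)
    (u : EuclideanSpace ℝ (Fin d)) :
    charFun ((P.restrict F).map (noise A W s r)) u =
      P.real F * Complex.exp (-((∫ x in (0 : ℝ)..r,
        ‖Matrix.toEuclideanCLM (𝕜 := ℝ)
          (NormedSpace.exp (((r : ℝ) - x) • A))ᵀ u‖ ^ 2) / 2 : ℝ)) := by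
  have h1 := tendsto_charFun_map_of_ae_tendsto (P := P.restrict F)
    (fun n ↦ (hW.measurable_noiseSum A s r n).aemeasurable)
    (hW.aemeasurable_noise A s r).restrict
    (ae_restrict_of_ae (hW.ae_continuous.mono fun _ hω ↦ tendsto_noiseSum A hω s r)) u
  refine tendsto_nhds_unique h1 ?_
  simp_rw [hW.charFun_map_restrict_noiseSum A r hF]
  have h2 := tendsto_riemann_sum_uniformGrid (continuous_norm_sq_exp_transpose A r u) r.2
  have hc : Continuous fun x : ℝ ↦ (P.real F : ℂ) * Complex.exp (-(x / 2 : ℝ)) := by fun_prop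
  exact (hc.tendsto _).comp h2

/-- The noise after time `s` is Gaussian and independent of `ℱ s`. -/
lemma map_restrict_noise (hW : IsBrownianMotion W ℱ P) (A : Matrix (Fin d) (Fin d) ℝ) (γ : ℝ)
    {s : ℝ≥0} (r : ℝ≥0) {F : Set Ω} (hF : MeasurableSet[ℱ s] F) :
    (P.restrict F).map (fun ω ↦ γ • noise A W s r ω) =
      P F • multivariateGaussian 0 (covMatrix A γ r) := by
  have : IsFiniteMeasure (P F • multivariateGaussian 0 (covMatrix A γ r)) :=
    Measure.smul_finite _ (measure_ne_top P F)
  refine Measure.ext_of_charFun (funext fun u ↦ ?_)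
  rw [charFun_map_smul_comp (hW.aemeasurable_noise A s r).restrict,
    hW.charFun_map_restrict_noise A r hF, charFun_apply, integral_smul_measure, ← charFun_apply,
    charFun_multivariateGaussian (covMatrix_posSemidef A γ r), dotProduct_covMatrix_mulVec]
  simp_rw [map_smul, norm_smul, mul_pow, intervalIntegral.integral_const_mul]
  simp [Measure.real]

lemma hasLaw_noise (hW : IsBrownianMotion W ℱ P) (A : Matrix (Fin d) (Fin d) ℝ) (γ : ℝ)
    (s r : ℝ≥0) :
    HasLaw (fun ω ↦ γ • noise A W s r ω) (multivariateGaussian 0 (covMatrix A γ r)) P :=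
  ⟨(hW.aemeasurable_noise A s r).const_smul γ, by
    simpa using hW.map_restrict_noise A γ r (MeasurableSet.univ (α := Ω))⟩

end IsBrownianMotion

end LocalGlobal

/-! ### Solutions of the SDE: existence, law and Markov property -/

namespace LocalGlobal

variable {Ω : Type*} {mΩ : MeasurableSpace Ω} {d : ℕ} {P : Measure Ω} {ℱ : Filtration ℝ≥0 mΩ}
  {W Θ : ℝ≥0 → Ω → EuclideanSpace ℝ (Fin d)} {A : Matrix (Fin d) (Fin d) ℝ} {γ : ℝ}

lemma linearDrift_eq (A : Matrix (Fin d) (Fin d) ℝ) (t : ℝ≥0) (θ : EuclideanSpace ℝ (Fin d)) :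
    linearDrift A t θ = Matrix.toEuclideanCLM (𝕜 := ℝ) A θ := rfl

/-- The flow property of solutions of a linear equation with additive noise. -/
lemma IsSDESolution.ae_eq_add (hW : IsBrownianMotion W ℱ P)
    (hΘ : IsSDESolution (linearDrift A) γ 0 W ℱ P Θ) :
    ∀ᵐ ω ∂P, ∀ s r : ℝ≥0, Θ (s + r) ω =
      Matrix.toEuclideanCLM (𝕜 := ℝ) (NormedSpace.exp ((r : ℝ) • A)) (Θ s ω) +
        γ • noise A W s r ω := by
  filter_upwards [hW.ae_continuous, hΘ.cont, hΘ.eq] with ω hWc hΘc heq s r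
  set L := Matrix.toEuclideanCLM (𝕜 := ℝ) A with hL
  have hx : Continuous fun u : ℝ ↦ Θ (s + u.toNNReal) ω :=
    hΘc.comp (continuous_const.add continuous_real_toNNReal)
  have hLc : Continuous fun u : ℝ ↦ L (Θ u.toNNReal ω) :=
    L.continuous.comp (hΘc.comp continuous_real_toNNReal)
  have hw : Continuous fun u ↦ γ • shiftedPath W s ω u :=
    (continuous_shiftedPath hWc s).const_smul γ
  simp_rw [linearDrift_eq, ← hL, zero_add] at heq
  have key := eq_exp_add_linearResponse L hw hx (x₀ := Θ s ω) (fun u hu ↦ ?_) r.2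
  · rw [linearResponse_smul, ← Matrix.toEuclideanCLM_exp_smul] at key
    simpa [noise] using key
  · have hint : ∫ v in 0..u, L (Θ (s + v.toNNReal) ω) =
        ∫ v in (s : ℝ)..(s + u.toNNReal : ℝ≥0), L (Θ v.toNNReal ω) := by
      have h1 : ∫ v in 0..u, L (Θ (s + v.toNNReal) ω) =
          ∫ v in 0..u, L (Θ ((v + (s : ℝ)).toNNReal) ω) := by
        refine intervalIntegral.integral_congr fun v hv ↦ ?_
        rw [Set.uIcc_of_le hu] at hv
        rw [Real.toNNReal_add hv.1 s.coe_nonneg, Real.toNNReal_coe, add_comm]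
      rw [h1, intervalIntegral.integral_comp_add_right (fun v ↦ L (Θ v.toNNReal ω))]
      congr 1
      · simp
      · push_cast
        rw [Real.coe_toNNReal _ hu, add_comm]
    have hsub := intervalIntegral.integral_interval_sub_left
      (hLc.intervalIntegrable (μ := volume) 0 (s + u.toNNReal : ℝ≥0))
      (hLc.intervalIntegrable (μ := volume) 0 s)
    rw [hint, ← hsub, heq (s + u.toNNReal)]
    conv_rhs => rw [heq s]
    simp only [shiftedPath, smul_sub]
    abel

lemma IsSDESolution.ae_eq_noise (hW : IsBrownianMotion W ℱ P)
    (hΘ : IsSDESolution (linearDrift A) γ 0 W ℱ P Θ) :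
    ∀ᵐ ω ∂P, ∀ t : ℝ≥0, Θ t ω = γ • noise A W 0 t ω := by
  filter_upwards [hΘ.ae_eq_add hW, hΘ.eq, hW.ae_eval_zero] with ω h heq h0 t
  have hΘ0 : Θ 0 ω = 0 := by simpa [h0] using heq 0
  simpa [hΘ0] using h 0 t

lemma noise_zero_eq {ω : Ω} (h0 : W 0 ω = 0) (t : ℝ≥0) :
    noise A W 0 t ω = linearResponse (Matrix.toEuclideanCLM (𝕜 := ℝ) A)
      (fun u ↦ W u.toNNReal ω) t := by
  have : shiftedPath W 0 ω = fun u ↦ W u.toNNReal ω := by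
    ext u : 1
    simp [shiftedPath, h0]
  rw [noise, this]

/-- A linear equation with additive noise has a solution. -/
lemma exists_isSDESolution (hW : IsBrownianMotion W ℱ P) (A : Matrix (Fin d) (Fin d) ℝ) (γ : ℝ) :
    ∃ Θ, IsSDESolution (linearDrift A) γ 0 W ℱ P Θ := by
  -- The variation of constants formula is a limit of the sums only off a null set, which need not
  -- belong to `ℱ t`. Taking `limUnder` of the adapted sums gives a process that is adapted at every
  -- `ω`.
  set Θ : ℝ≥0 → Ω → EuclideanSpace ℝ (Fin d) :=
    fun t ω ↦ γ • limUnder atTop fun n ↦ noiseSum A W 0 t n ω with hΘ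
  set L := Matrix.toEuclideanCLM (𝕜 := ℝ) A with hL
  have hmain : ∀ᵐ ω ∂P, Continuous (fun t ↦ W t ω) ∧ ∀ t, Θ t ω =
      linearResponse L (fun u ↦ γ • W u.toNNReal ω) t := by
    filter_upwards [hW.ae_continuous, hW.ae_eval_zero] with ω hc h0
    refine ⟨hc, fun t ↦ ?_⟩
    simp only [hΘ]
    rw [(tendsto_noiseSum A hc 0 t).limUnder_eq, noise_zero_eq h0, linearResponse_smul]
  have hcont : ∀ᵐ ω ∂P, Continuous fun t ↦ Θ t ω := by
    filter_upwards [hmain] with ω hω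
    simp_rw [hω.2]
    have hc := hω.1
    exact (continuous_linearResponse L (by fun_prop)).comp NNReal.continuous_coe
  refine ⟨Θ, fun t ↦ ?_, hcont, ?_, ?_⟩
  · have h : StronglyMeasurable[ℱ (0 + t)] fun ω ↦
        limUnder atTop fun n ↦ noiseSum A W 0 t n ω :=
      @StronglyMeasurable.limUnder _ _ _ (ℱ (0 + t)) _ _ _ _ _ _ _
        fun n ↦ hW.stronglyMeasurable_noiseSum A 0 t n
    rw [zero_add] at h
    exact h.const_smul γ
  · filter_upwards [hcont] with ω hω t
    exact (L.continuous.comp (hω.comp continuous_real_toNNReal)).intervalIntegrable _ _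
  · filter_upwards [hmain] with ω hω t
    have hc := hω.1
    simp_rw [hω.2, linearDrift_eq]
    rw [linearResponse_eq L (by fun_prop) t, zero_add, Real.toNNReal_coe]
    congr 1
    refine intervalIntegral.integral_congr fun s hs ↦ ?_
    rw [Set.uIcc_of_le t.coe_nonneg] at hs
    rw [Real.coe_toNNReal _ hs.1]

variable [IsProbabilityMeasure P]

lemma IsSDESolution.isGaussianProcess (hW : IsBrownianMotion W ℱ P)
    (hΘ : IsSDESolution (linearDrift A) γ 0 W ℱ P Θ) : IsGaussianProcess Θ P := by
  have hint (t : ℝ≥0) : Integrable (W t) P :=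
    (hW.isGaussianProcess.hasGaussianLaw_eval t).integrable
  have hN : IsGaussianProcess (fun t ω ↦ noise A W 0 t ω) P := by
    refine isGaussianProcess_of_ae_tendsto (X := fun n t ω ↦ noiseSum A W 0 t n ω)
      (fun n ↦ ?_) (fun n t ↦ ?_)
      fun t ↦ hW.ae_continuous.mono fun ω hω ↦ tendsto_noiseSum A hω 0 t
    · exact hW.isGaussianProcess.sum_increments (fun _ ↦ n + 1)
        (fun (t : ℝ≥0) k ↦ 0 + (uniformGrid t n k).toNNReal) fun t k ↦
          Matrix.toEuclideanCLM (𝕜 := ℝ) (NormedSpace.exp (((t : ℝ) - uniformGrid t n k) • A))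
    · exact integral_sum_increments_eq_zero hint hW.integral_eval (n + 1)
        (fun k ↦ 0 + (uniformGrid t n k).toNNReal) fun k ↦
          Matrix.toEuclideanCLM (𝕜 := ℝ) (NormedSpace.exp (((t : ℝ) - uniformGrid t n k) • A))
  refine (hN.smul fun _ ↦ γ).congr fun t ↦ ?_
  filter_upwards [hΘ.ae_eq_noise hW] with ω hω using (hω t).symm

lemma IsSDESolution.hasLaw (hW : IsBrownianMotion W ℱ P)
    (hΘ : IsSDESolution (linearDrift A) γ 0 W ℱ P Θ) (t : ℝ≥0) :
    HasLaw (Θ t) (multivariateGaussian 0 (covMatrix A γ t)) P :=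
  (hW.hasLaw_noise A γ 0 t).congr ((hΘ.ae_eq_noise hW).mono fun _ hω ↦ hω t)

lemma IsSDESolution.integral_apply (hW : IsBrownianMotion W ℱ P)
    (hΘ : IsSDESolution (linearDrift A) γ 0 W ℱ P Θ) (t : ℝ≥0) (i : Fin d) :
    ∫ ω, Θ t ω i ∂P = 0 := by
  have hlaw := hΘ.hasLaw hW t
  have h := hlaw.integral_comp (f := fun x ↦ x i) (by fun_prop)
  rw [show ∫ ω, Θ t ω i ∂P = _ from h]
  have h2 := (EuclideanSpace.proj (𝕜 := ℝ) i).integral_comp_comm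
    (IsGaussian.integrable_id (μ := multivariateGaussian 0 (covMatrix A γ t)))
  simpa using h2

lemma IsSDESolution.covariance_apply (hW : IsBrownianMotion W ℱ P)
    (hΘ : IsSDESolution (linearDrift A) γ 0 W ℱ P Θ) (t : ℝ≥0) (i j : Fin d) :
    cov[fun ω ↦ Θ t ω i, fun ω ↦ Θ t ω j; P] = covMatrix A γ t i j := by
  rw [← covariance_eval_multivariateGaussian (μ := 0) (covMatrix_posSemidef A γ t)]
  exact (hΘ.hasLaw hW t).covariance_fun_comp (f := fun x ↦ x i) (g := fun x ↦ x j)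
    (by fun_prop) (by fun_prop)

lemma multivariateGaussian_eq_map (m : EuclideanSpace ℝ (Fin d)) (S : Matrix (Fin d) (Fin d) ℝ) :
    multivariateGaussian m S = (multivariateGaussian 0 S).map (fun x ↦ m + x) := by
  unfold multivariateGaussian
  rw [Measure.map_map (by fun_prop) (by fun_prop)]
  simp [Function.comp_def]

/-- The Markov property with Gaussian transition laws. -/
lemma IsSDESolution.condExp_preimage (hW : IsBrownianMotion W ℱ P)
    (hΘ : IsSDESolution (linearDrift A) γ 0 W ℱ P Θ) {s t : ℝ≥0} (hst : s ≤ t)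
    {B : Set (EuclideanSpace ℝ (Fin d))} (hB : MeasurableSet B) :
    P⟦Θ t ⁻¹' B | ℱ s⟧ =ᵐ[P] fun ω ↦ (transitionLaw A γ (t - s) (Θ s ω)).real B := by
  set ν := multivariateGaussian 0 (covMatrix A γ (t - s)) with hν
  set T := Matrix.toEuclideanCLM (𝕜 := ℝ) (NormedSpace.exp (((t - s : ℝ≥0) : ℝ) • A)) with hT
  set N : Ω → EuclideanSpace ℝ (Fin d) := fun ω ↦ γ • noise A W s (t - s) ω with hN
  have hNm : AEMeasurable N P := (hW.aemeasurable_noise A s (t - s)).const_smul γ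
  have hΘm (r : ℝ≥0) : Measurable (Θ r) := ((hΘ.adapted r).mono (ℱ.le r)).measurable
  have hC : MeasurableSet {p : EuclideanSpace ℝ (Fin d) × EuclideanSpace ℝ (Fin d) |
      T p.1 + p.2 ∈ B} := by
    have : Measurable fun p : EuclideanSpace ℝ (Fin d) × EuclideanSpace ℝ (Fin d) ↦
      T p.1 + p.2 := by fun_prop
    exact this hB
  have htrans (x : EuclideanSpace ℝ (Fin d)) :
      transitionLaw A γ (t - s) x B = ν (Prod.mk x ⁻¹' {p | T p.1 + p.2 ∈ B}) := by
    rw [transitionLaw, multivariateGaussian_eq_map, Measure.map_apply (by fun_prop) hB]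
    rfl
  have hmeas : Measurable fun x ↦ transitionLaw A γ (t - s) x B := by
    simp_rw [htrans]
    exact measurable_measure_prodMk_left hC
  have hprob (x : EuclideanSpace ℝ (Fin d)) :
      IsProbabilityMeasure (transitionLaw A γ (t - s) x) := by
    unfold transitionLaw; infer_instance
  have hEq : ∀ᵐ ω ∂P, Θ t ω = T (Θ s ω) + N ω := by
    filter_upwards [hΘ.ae_eq_add hW] with ω hω
    have := hω s (t - s)
    rwa [add_tsub_cancel_of_le hst] at this
  -- On each `F` in `ℱ s`, the new noise is independent of `Θ s`: apply `map_restrict_noise` to the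
  -- events `F ∩ Θ s ⁻¹' C`. Tonelli's theorem then yields the defining integrals of the conditional
  -- expectation.
  have hprod (F : Set Ω) (hF : MeasurableSet[ℱ s] F) :
      (P.restrict F).map (fun ω ↦ (Θ s ω, N ω)) = ((P.restrict F).map (Θ s)).prod ν := by
    refine (Measure.prod_eq fun C D hC hD ↦ ?_).symm
    have hFC : MeasurableSet[ℱ s] (F ∩ Θ s ⁻¹' C) :=
      hF.inter ((hΘ.adapted s).measurable hC)
    have h1 := congrArg (fun μ ↦ μ D) (hW.map_restrict_noise A γ (t - s) hFC)
    simp only [Measure.smul_apply, smul_eq_mul] at h1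
    rw [Measure.map_apply_of_aemeasurable ((hΘm s).aemeasurable.prodMk hNm.restrict) (hC.prod hD),
      Measure.map_apply (hΘm s) hC, Measure.restrict_apply ((hΘm s) hC), Set.inter_comm _ F,
      hν, ← h1, Measure.map_apply_of_aemeasurable hNm.restrict hD,
      Set.mk_preimage_prod, Set.inter_comm F, ← Measure.restrict_restrict ((hΘm s) hC),
      Measure.restrict_apply' ((hΘm s) hC), Set.inter_comm]
  symm
  refine ae_eq_condExp_of_forall_setIntegral_eq (ℱ.le s) ?_ (fun F _ _ ↦ ?_) (fun F hF _ ↦ ?_) ?_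
  · exact (integrable_const (1 : ℝ)).indicator ((hΘm t) hB)
  · refine Integrable.integrableOn ?_
    refine Integrable.of_bound (C := 1) ?_ (ae_of_all _ fun ω ↦ ?_)
    · exact (hmeas.comp (hΘm s)).ennreal_toReal.aestronglyMeasurable
    · simp [abs_of_nonneg]
  · have hpair : AEMeasurable (fun ω ↦ (Θ s ω, N ω)) (P.restrict F) :=
      (hΘm s).aemeasurable.prodMk hNm.restrict
    have h2 : P.restrict F (Θ t ⁻¹' B) = ∫⁻ ω in F, transitionLaw A γ (t - s) (Θ s ω) B ∂P := by
      calc P.restrict F (Θ t ⁻¹' B)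
          = P.restrict F ((fun ω ↦ (Θ s ω, N ω)) ⁻¹' {p | T p.1 + p.2 ∈ B}) := by
            refine measure_congr ?_
            filter_upwards [ae_restrict_of_ae hEq] with ω hω
            change (Θ t ω ∈ B) = (T (Θ s ω) + N ω ∈ B)
            rw [hω]
        _ = ((P.restrict F).map (Θ s)).prod ν {p | T p.1 + p.2 ∈ B} := by
            rw [← hprod F hF, Measure.map_apply_of_aemeasurable hpair hC]
        _ = _ := by
            rw [Measure.prod_apply hC, lintegral_map (measurable_measure_prodMk_left hC) (hΘm s)]
            simp_rw [htrans]
    rw [integral_indicator ((hΘm t) hB), setIntegral_const, smul_eq_mul, mul_one, Measure.real, h2]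
    exact integral_toReal (hmeas.comp (hΘm s)).aemeasurable
      (ae_of_all _ fun ω ↦ measure_lt_top _ _)
  · refine StronglyMeasurable.aestronglyMeasurable ?_
    exact (hmeas.comp (hΘ.adapted s).measurable).ennreal_toReal.stronglyMeasurable

end LocalGlobal

/-! ### Wiener integrals -/

namespace LocalGlobal

/-- The step function with the values of `f` at the left endpoints of a uniform partition. -/
noncomputable def uniformStep (f : ℝ → ℝ) (t : ℝ≥0) (n : ℕ) : StepFunction where
  size := n + 1
  node k := (uniformGrid t n k).toNNReal
  mono _ _ h := Real.toNNReal_le_toNNReal (uniformGrid.mono t.2 h)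
  coeff k := f (uniformGrid t n k)

lemma uniformStep_integral {Ω : Type*} (f : ℝ → ℝ) (t : ℝ≥0) (n : ℕ) (B : ℝ≥0 → Ω → ℝ) (ω : Ω) :
    (uniformStep f t n).integral B ω = ∑ k ∈ Finset.range (n + 1), f (uniformGrid t n k) *
      (B (uniformGrid t n (k + 1)).toNNReal ω - B (uniformGrid t n k).toNNReal ω) := by
  rw [Finset.sum_range, StepFunction.integral]
  rfl

lemma exists_mem_Ioc_uniformGrid {t s : ℝ} (hs : s ∈ Set.Ioc 0 t) (n : ℕ) :
    ∃ k < n + 1, s ∈ Set.Ioc (uniformGrid t n k) (uniformGrid t n (k + 1)) := by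
  classical
  have hex : ∃ m, s ≤ uniformGrid t n m := ⟨n + 1, by simpa using hs.2⟩
  have hfind := Nat.find_spec hex
  have hle : Nat.find hex ≤ n + 1 := Nat.find_min' hex (by simpa using hs.2)
  obtain ⟨k, hk⟩ : ∃ k, Nat.find hex = k + 1 := by
    refine Nat.exists_eq_succ_of_ne_zero fun h0 ↦ ?_
    rw [h0, uniformGrid.zero_right] at hfind
    exact hfind.not_gt hs.1
  refine ⟨k, by lia, not_le.1 (Nat.find_min hex (by lia)), hk ▸ hfind⟩

lemma uniformStep_eval (f : ℝ → ℝ) (t : ℝ≥0) {n k : ℕ} (hk : k < n + 1) {s : ℝ}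
    (hs : s ∈ Set.Ioc (uniformGrid t n k) (uniformGrid t n (k + 1))) :
    (uniformStep f t n).eval s = f (uniformGrid t n k) := by
  have hg (l : ℕ) : ((uniformGrid t n l).toNNReal : ℝ) = uniformGrid t n l :=
    Real.coe_toNNReal _ (uniformGrid.nonneg t.2)
  have heval : (uniformStep f t n).eval s = ∑ l ∈ Finset.range (n + 1),
      (Set.Ioc (uniformGrid t n l) (uniformGrid t n (l + 1))).indicator
        (fun _ ↦ f (uniformGrid t n l)) s := by
    rw [Finset.sum_range, StepFunction.eval]
    refine Finset.sum_congr rfl fun l _ ↦ ?_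
    simp only [uniformStep, hg]
    rfl
  rw [heval, Finset.sum_eq_single_of_mem k (Finset.mem_range.2 hk), Set.indicator_of_mem hs]
  intro l _ hlk
  refine Set.indicator_of_notMem (fun hsl ↦ ?_) _
  rcases lt_or_gt_of_ne hlk with h | h
  · exact (hsl.2.trans (uniformGrid.mono t.2 (Nat.succ_le_of_lt h))).not_gt hs.1
  · exact (hs.2.trans (uniformGrid.mono t.2 (Nat.succ_le_of_lt h))).not_gt hsl.1

lemma tendsto_eLpNorm_uniformStep_sub {f : ℝ → ℝ} (hf : Continuous f) (t : ℝ≥0) :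
    Tendsto (fun n ↦ eLpNorm (fun s ↦ (uniformStep f t n).eval s - f s) 2
      (volume.restrict (Set.Icc (0 : ℝ) t))) atTop (𝓝 0) := by
  set K := (volume.restrict (Set.Icc (0 : ℝ) t)) Set.univ ^ (2 : ℝ≥0∞).toReal⁻¹ with hK
  have hKtop : K ≠ ⊤ := ENNReal.rpow_ne_top_of_nonneg (by positivity) (measure_ne_top _ _)
  have hbound (δ : ℝ) (hδ : 0 < δ) : ∀ᶠ n in atTop,
      eLpNorm (fun s ↦ (uniformStep f t n).eval s - f s) 2
        (volume.restrict (Set.Icc (0 : ℝ) t)) ≤ K * ENNReal.ofReal δ := by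
    obtain ⟨N, hN⟩ := exists_forall_uniformGrid_abs_sub_lt hf t.2 hδ
    filter_upwards [eventually_ge_atTop N] with n hn
    refine eLpNorm_le_of_ae_bound ?_
    -- The half-open cells of the partition miss the point `0`, which is a null set.
    rw [← restrict_Ioc_eq_restrict_Icc]
    filter_upwards [ae_restrict_mem measurableSet_Ioc] with s hs
    obtain ⟨k, hk, hsk⟩ := exists_mem_Ioc_uniformGrid hs n
    rw [uniformStep_eval f t hk hsk]
    exact (hN n hn k hk _ ⟨le_rfl, hsk.1.le.trans hsk.2⟩ _ ⟨hsk.1.le, hsk.2⟩).le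
  have hlim : Tendsto (fun δ : ℝ ↦ K * ENNReal.ofReal δ) (𝓝[>] 0) (𝓝 0) := by
    have h := ENNReal.Tendsto.const_mul (a := K)
      ((ENNReal.continuous_ofReal.tendsto 0).mono_left nhdsWithin_le_nhds) (Or.inr hKtop)
      (f := 𝓝[>] (0 : ℝ))
    simpa using h
  rw [ENNReal.tendsto_nhds_zero]
  intro ε hε
  obtain ⟨δ, hδ, hδ0⟩ := ((hlim.eventually (ge_mem_nhds hε)).and self_mem_nhdsWithin).exists
  exact (hbound δ hδ0).mono fun n hn ↦ hn.trans hδ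

/-- The Wiener integral of a continuously differentiable function, by integration by parts. -/
lemma isWienerIntegral_of_hasDerivAt {Ω : Type*} {mΩ : MeasurableSpace Ω} {P : Measure Ω}
    [IsProbabilityMeasure P] {B : ℝ≥0 → Ω → ℝ} (hB : IsBrownianReal B P) {f f' : ℝ → ℝ}
    (hf : ∀ s, HasDerivAt f (f' s) s) (hf' : Continuous f') (t : ℝ≥0) :
    IsWienerIntegral f t B P
      (fun ω ↦ f t * B t ω - ∫ s in (0 : ℝ)..t, f' s * B s.toNNReal ω) := by
  have hfc : Continuous f := continuous_iff_continuousAt.2 fun s ↦ (hf s).continuousAt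
  refine ⟨uniformStep f t, fun n k ↦ ?_, tendsto_eLpNorm_uniformStep_sub hfc t, ?_⟩
  · exact Real.toNNReal_le_iff_le_coe.2 (uniformGrid.le_last t.2 (Nat.lt_succ_iff.1 k.2))
  have hint (s : ℝ≥0) : Integrable (B s) P := hB.integrable_eval s
  have hmul (n : ℕ) : (fun ω ↦ (uniformStep f t n).integral B ω) =
      fun ω ↦ ∑ k ∈ Finset.range (n + 1), ContinuousLinearMap.mul ℝ ℝ (f (uniformGrid t n k))
        (B (uniformGrid t n (k + 1)).toNNReal ω - B (uniformGrid t n k).toNNReal ω) := by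
    ext ω
    simp [uniformStep_integral]
  have hG : IsGaussianProcess (fun n ω ↦ (uniformStep f t n).integral B ω) P := by
    simp_rw [hmul]
    exact hB.isGaussianProcess.sum_increments (fun n ↦ n + 1)
      (fun n k ↦ (uniformGrid t n k).toNNReal)
      fun n k ↦ ContinuousLinearMap.mul ℝ ℝ (f (uniformGrid t n k))
  have h0 (n : ℕ) : ∫ ω, (uniformStep f t n).integral B ω ∂P = 0 := by
    rw [hmul]
    exact integral_sum_increments_eq_zero hint hB.integral_eval (n + 1)
      (fun k ↦ (uniformGrid t n k).toNNReal)
      fun k ↦ ContinuousLinearMap.mul ℝ ℝ (f (uniformGrid t n k))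
  refine tendsto_eLpNorm_sub_of_ae_tendsto (fun n m ↦ hG.hasGaussianLaw_fun_sub)
    (fun n m ↦ ?_) ?_
  · rw [integral_sub (hG.hasGaussianLaw_eval n).integrable (hG.hasGaussianLaw_eval m).integrable,
      h0, h0, sub_zero]
  · filter_upwards [hB.cont, hB.eval_zero_ae_eq_zero] with ω hc hz
    have h := tendsto_stieltjes_sum_uniformGrid hf hf' (b := fun s ↦ B s.toNNReal ω)
      (hc.comp continuous_real_toNNReal) (by simpa using hz) t.2
    simp_rw [uniformStep_integral]
    simpa using h

variable {Ω : Type*} {mΩ : MeasurableSpace Ω} {d : ℕ} {P : Measure Ω} {ℱ : Filtration ℝ≥0 mΩ}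
  {W Θ : ℝ≥0 → Ω → EuclideanSpace ℝ (Fin d)} {A : Matrix (Fin d) (Fin d) ℝ} {γ : ℝ}

/-- Solutions of the linear equation are stochastic convolutions. -/
lemma IsSDESolution.exists_isWienerIntegral [IsProbabilityMeasure P]
    (hW : IsBrownianMotion W ℱ P) (hΘ : IsSDESolution (linearDrift A) γ 0 W ℱ P Θ) (t : ℝ≥0) :
    ∃ Z : Fin d → Fin d → Ω → ℝ,
      (∀ i j, IsWienerIntegral (fun s ↦ NormedSpace.exp (((t : ℝ) - s) • A) i j) t
        (fun r ω ↦ W r ω j) P (Z i j)) ∧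
      ∀ᵐ ω ∂P, ∀ i, Θ t ω i = γ * ∑ j, Z i j ω := by
  -- Unification takes `Z i j` to be the integrated-by-parts expression; its sum over `j` is the
  -- coordinate formula in `linearResponse_toEuclideanCLM_apply`.
  refine ⟨_, fun i j ↦ isWienerIntegral_of_hasDerivAt (hW.coord j)
    (fun s ↦ Matrix.hasDerivAt_exp_const_sub_smul_apply A t s i j)
    (Matrix.continuous_exp_const_sub_smul_mul_apply A t i j).neg t, ?_⟩
  filter_upwards [hΘ.ae_eq_noise hW, hW.ae_continuous, hW.ae_eval_zero] with ω h hc h0 i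
  have hc' : Continuous fun u : ℝ ↦ W u.toNNReal ω := hc.comp continuous_real_toNNReal
  rw [h t, noise_zero_eq h0, PiLp.smul_apply, smul_eq_mul,
    linearResponse_toEuclideanCLM_apply A hc', Real.toNNReal_coe]

end LocalGlobal

/-! ### Gaussian densities and their failure to factor -/

lemma MeasureTheory.Measure.AbsolutelyContinuous.pi_fin {n : ℕ} {μ ν : Measure ℝ}
    [SigmaFinite μ] [SigmaFinite ν] (h : μ ≪ ν) :
    Measure.pi (fun _ : Fin n ↦ μ) ≪ Measure.pi fun _ ↦ ν := by
  induction n with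
  | zero => rw [Measure.pi_of_empty, Measure.pi_of_empty]
  | succ n ih =>
    have hμ := (measurePreserving_piFinSuccAbove (fun _ : Fin (n + 1) ↦ μ) 0).symm
    have hν := (measurePreserving_piFinSuccAbove (fun _ : Fin (n + 1) ↦ ν) 0).symm
    rw [← hμ.map_eq, ← hν.map_eq]
    exact (h.prod ih).map (MeasurableEquiv.measurable _)

open scoped MatrixOrder in
-- The law is the image of the standard Gaussian under `x ↦ m + √S x`. Since `√S` squares to `S`,
-- its determinant is nonzero, and preimages of null sets under this affine map are null.
lemma ProbabilityTheory.multivariateGaussian_absolutelyContinuous {d : ℕ}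
    (m : EuclideanSpace ℝ (Fin d)) {S : Matrix (Fin d) (Fin d) ℝ} (hS : S.PosDef) :
    multivariateGaussian m S ≪ volume := by
  have hstd : stdGaussian (EuclideanSpace ℝ (Fin d)) ≪ volume := by
    rw [← map_pi_eq_stdGaussian, ← (PiLp.volume_preserving_toLp (Fin d)).map_eq]
    exact ((gaussianReal_absolutelyContinuous 0 one_ne_zero).pi_fin).map (by fun_prop)
  set L := Matrix.toEuclideanCLM (𝕜 := ℝ) (CFC.sqrt S) with hL
  have hdet : LinearMap.det (L : EuclideanSpace ℝ (Fin d) →ₗ[ℝ] EuclideanSpace ℝ (Fin d)) ≠ 0 := by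
    rw [hL, Matrix.coe_toEuclideanCLM_eq_toEuclideanLin, Matrix.toEuclideanLin_eq_toLin_orthonormal,
      LinearMap.det_toLin]
    intro h0
    have h1 : CFC.sqrt S * CFC.sqrt S = S := CFC.sqrt_mul_sqrt_self _ hS.posSemidef.nonneg
    have h2 := congrArg Matrix.det h1
    rw [Matrix.det_mul, h0, zero_mul] at h2
    exact hS.det_pos.ne h2
  refine (hstd.map (f := fun x ↦ m + L x) (by fun_prop)).trans
    (Measure.AbsolutelyContinuous.mk fun s hs h0 ↦ ?_)
  rw [Measure.map_apply (by fun_prop) hs]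
  have hpre : (fun x ↦ m + L x) ⁻¹' s =
      (L : EuclideanSpace ℝ (Fin d) →ₗ[ℝ] EuclideanSpace ℝ (Fin d)) ⁻¹'
        ((fun x ↦ m + x) ⁻¹' s) := rfl
  rw [hpre, Measure.addHaar_preimage_linearMap _ hdet, measure_preimage_add, h0, mul_zero]

namespace LocalGlobal

variable {d : ℕ}

/-- If a probability density factors across `S`, then the coordinates in `S` are independent of
the others. -/
lemma DensityFactorsAcross.indepFun {S : Finset (Fin d)}
    {μ : Measure (EuclideanSpace ℝ (Fin d))} [IsProbabilityMeasure μ]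
    (h : DensityFactorsAcross S μ) :
    IndepFun (fun y (i : {i // i ∈ S}) ↦ y i) (fun y (i : {i // i ∉ S}) ↦ y i) μ := by
  obtain ⟨q, r, hq, hr, hμ⟩ := h
  have hmp : MeasurePreserving (fun y : EuclideanSpace ℝ (Fin d) ↦
      ((fun i : {i // i ∈ S} ↦ y i, fun i : {i // i ∉ S} ↦ y i) :
        ({i // i ∈ S} → ℝ) × ({i // i ∉ S} → ℝ))) := by
    have key := (volume_preserving_piEquivPiSubtypeProd (fun _ ↦ ℝ) (fun i ↦ i ∈ S)).comp
      (PiLp.volume_preserving_ofLp (Fin d))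
    rw [Subsingleton.elim (Subtype.fintype fun i ↦ i ∈ S) (Finset.Subtype.fintype S)] at key
    exact key
  have hbox (C : Set ({i // i ∈ S} → ℝ)) (D : Set ({i // i ∉ S} → ℝ)) (hC : MeasurableSet C)
      (hD : MeasurableSet D) :
      μ ((fun y (i : {i // i ∈ S}) ↦ y i) ⁻¹' C ∩ (fun y (i : {i // i ∉ S}) ↦ y i) ⁻¹' D) =
        (∫⁻ x, C.indicator q x) * ∫⁻ x, D.indicator r x := by
    have hCD : MeasurableSet ((fun (y : EuclideanSpace ℝ (Fin d)) (i : {i // i ∈ S}) ↦ y i) ⁻¹' C ∩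
        (fun y (i : {i // i ∉ S}) ↦ y i) ⁻¹' D) :=
      (measurable_fst.comp hmp.measurable hC).inter (measurable_snd.comp hmp.measurable hD)
    rw [← lintegral_prod_mul (hq.indicator hC).aemeasurable (hr.indicator hD).aemeasurable,
      ← Measure.volume_eq_prod, ← hmp.lintegral_comp
        (f := fun z ↦ C.indicator q z.1 * D.indicator r z.2)
        (((hq.indicator hC).comp measurable_fst).mul ((hr.indicator hD).comp measurable_snd)),
      hμ, withDensity_apply _ hCD, ← lintegral_indicator hCD]
    refine lintegral_congr fun y ↦ ?_
    by_cases h1 : (fun i : {i // i ∈ S} ↦ y i) ∈ C <;>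
      by_cases h2 : (fun i : {i // i ∉ S} ↦ y i) ∈ D <;>
      simp [Set.indicator, h1, h2]
  -- Neither `q` nor `r` need have mass `1`; only the product of their masses is normalized, and
  -- that is what cancels below.
  have htot : (∫⁻ x, q x) * ∫⁻ x, r x = 1 := by
    simpa using (hbox Set.univ Set.univ .univ .univ).symm
  rw [indepFun_iff_measure_inter_preimage_eq_mul]
  intro C D hC hD
  have h1 := hbox C Set.univ hC .univ
  have h2 := hbox Set.univ D .univ hD
  simp only [Set.preimage_univ, Set.inter_univ, Set.univ_inter, Set.indicator_univ] at h1 h2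
  rw [hbox C D hC hD, h1, h2, mul_comm (∫⁻ x, q x), mul_mul_mul_comm, mul_comm (∫⁻ x, r x), htot,
    mul_one]

/-- A nondegenerate Gaussian law with a dense covariance matrix has a density which does not
factor. -/
lemma hasNonfactoringDensity_multivariateGaussian (m : EuclideanSpace ℝ (Fin d))
    {S : Matrix (Fin d) (Fin d) ℝ} (hS : S.PosDef) (hne : ∀ i j, S i j ≠ 0) :
    HasNonfactoringDensity (multivariateGaussian m S) := by
  refine ⟨multivariateGaussian_absolutelyContinuous m hS, fun T hT hTu hfac ↦ ?_⟩
  obtain ⟨i, hi⟩ := hT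
  obtain ⟨j, hj⟩ : ∃ j, j ∉ T := by
    by_contra! hall
    exact hTu (Finset.eq_univ_iff_forall.2 hall)
  have hind : IndepFun (fun y : EuclideanSpace ℝ (Fin d) ↦ y i) (fun y ↦ y j)
      (multivariateGaussian m S) :=
    hfac.indepFun.comp (measurable_pi_apply (⟨i, hi⟩ : {i // i ∈ T}))
      (measurable_pi_apply (⟨j, hj⟩ : {j // j ∉ T}))
  have hL2 (k : Fin d) : MemLp (fun y : EuclideanSpace ℝ (Fin d) ↦ y k) 2
      (multivariateGaussian m S) :=
    (IsGaussian.memLp_two_id (μ := multivariateGaussian m S)).continuousLinearMap_comp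
      (EuclideanSpace.proj (𝕜 := ℝ) k)
  have h0 := hind.covariance_eq_zero (hL2 i) (hL2 j)
  rw [covariance_eval_multivariateGaussian hS.posSemidef] at h0
  exact hne i j h0

end LocalGlobal

/-! ### The exponential of `1 + N` for idempotent `N` -/

section Idempotent

lemma IsIdempotentElem.one_add_pow {R : Type*} [Ring R] [Algebra ℝ R] {N : R}
    (hN : IsIdempotentElem N) (k : ℕ) : (1 + N) ^ k = 1 + ((2 : ℝ) ^ k - 1) • N := by
  induction k with
  | zero => simp
  | succ k ih =>
    rw [pow_succ, ih, add_mul, one_mul, mul_add, mul_one, smul_mul_assoc, hN.eq]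
    module

/-- Since `(1 + N)^k = 1 + (2^k - 1) N`, the exponential series splits into the scalar series for
`e^r` and `e^{2r}`. -/
lemma IsIdempotentElem.exp_smul_one_add {d : ℕ} {N : Matrix (Fin d) (Fin d) ℝ}
    (hN : IsIdempotentElem N) (r : ℝ) :
    NormedSpace.exp (r • (1 + N)) =
      Real.exp r • (1 : Matrix (Fin d) (Fin d) ℝ) + (Real.exp (2 * r) - Real.exp r) • N := by
  have hexp (x : ℝ) : HasSum (fun k : ℕ ↦ x ^ k / (k.factorial : ℝ)) (Real.exp x) := by
    rw [Real.exp_eq_exp_ℝ]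
    exact NormedSpace.expSeries_div_hasSum_exp x
  have hsum := ((hexp r).smul_const (1 : Matrix (Fin d) (Fin d) ℝ)).add
    (((hexp (2 * r)).sub (hexp r)).smul_const N)
  rw [NormedSpace.exp_eq_tsum ℝ, ← hsum.tsum_eq]
  refine tsum_congr fun k ↦ ?_
  rw [smul_pow, hN.one_add_pow, mul_pow]
  module

end Idempotent

/-! ### The example matrix and its covariance -/

namespace LocalGlobal

variable {d : ℕ}

lemma isDecoupledDrift_exampleMatrix [NeZero d] :
    IsDecoupledDrift (0 : Fin d) (linearDrift (exampleMatrix d)) := by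
  refine ⟨fun i _ x φ ↦ x + ((i : ℕ) + 1) * φ, fun t θ i ↦ ?_⟩
  have h (j : Fin d) : ((j : ℕ) = 0) ↔ j = 0 := by rw [Fin.ext_iff, Fin.val_zero]
  simp [linearDrift, exampleMatrix, Matrix.mulVec, dotProduct, add_mul, Finset.sum_add_distrib, h]

/-- The matrix is `1 + N`, where `N` has only its first column nonzero. The top entry of that column
is `1`, so `N` is idempotent. -/
lemma exp_smul_exampleMatrix_apply (r : ℝ) (i j : Fin d) :
    NormedSpace.exp (r • exampleMatrix d) i j = (if i = j then Real.exp r else 0) +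
      (if (j : ℕ) = 0 then ((i : ℕ) + 1) * (Real.exp (2 * r) - Real.exp r) else 0) := by
  set N : Matrix (Fin d) (Fin d) ℝ := Matrix.of fun i j ↦
    ((i : ℕ) + 1 : ℝ) * (if (j : ℕ) = 0 then 1 else 0) with hNdef
  have hA : exampleMatrix d = 1 + N := by
    ext i j
    simp [exampleMatrix, N, Matrix.one_apply]
  have hN : IsIdempotentElem N := by
    ext i j
    have : NeZero d := ⟨fun h ↦ by subst h; exact i.elim0⟩
    have h (j : Fin d) : ((j : ℕ) = 0) ↔ j = 0 := by rw [Fin.ext_iff, Fin.val_zero]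
    simp [N, Matrix.mul_apply, h]
  rw [hA, hN.exp_smul_one_add]
  simp [N, Matrix.one_apply, mul_comm]

/-- Two rows of `exp(rA)` have nonnegative entries and positive first entries, so their dot product
is positive. Strictness needs `r = t - s > 0`, hence positivity on the open interval only: at `s =
t` the exponential is the identity. -/
lemma covMatrix_exampleMatrix_ne_zero {γ : ℝ} (hγ : γ ≠ 0) {t : ℝ≥0} (ht : 0 < t)
    (i j : Fin d) : covMatrix (exampleMatrix d) γ t i j ≠ 0 := by
  have : NeZero d := ⟨fun h ↦ by subst h; exact i.elim0⟩
  have hpos : 0 < ∫ s in (0 : ℝ)..t, (NormedSpace.exp (((t : ℝ) - s) • exampleMatrix d) *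
      (NormedSpace.exp (((t : ℝ) - s) • exampleMatrix d))ᵀ) i j := by
    refine intervalIntegral.intervalIntegral_pos_of_pos_on
      ((Matrix.continuous_exp_mul_transpose_apply _ _ _ _).intervalIntegrable _ _)
      (fun s hs ↦ ?_) ht
    have hr : 0 < (t : ℝ) - s := sub_pos.2 hs.2
    have hlt : 0 < Real.exp (2 * ((t : ℝ) - s)) - Real.exp ((t : ℝ) - s) :=
      sub_pos.2 (Real.exp_lt_exp.2 (by linarith))
    have h0 (k l : Fin d) : 0 ≤ NormedSpace.exp (((t : ℝ) - s) • exampleMatrix d) k l := by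
      rw [exp_smul_exampleMatrix_apply]
      split_ifs <;> positivity
    have h1 (k : Fin d) : 0 < NormedSpace.exp (((t : ℝ) - s) • exampleMatrix d) k 0 := by
      rw [exp_smul_exampleMatrix_apply, if_pos (Fin.val_zero d)]
      split_ifs <;> positivity
    rw [Matrix.mul_apply]
    exact Finset.sum_pos' (fun k _ ↦ mul_nonneg (h0 i k) (h0 j k))
      ⟨0, Finset.mem_univ _, mul_pos (h1 i) (h1 j)⟩
  exact mul_ne_zero (pow_ne_zero 2 hγ) hpos.ne'

lemma integral_exp_const_mul {k : ℝ} (hk : k ≠ 0) (t : ℝ) :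
    ∫ s in (0 : ℝ)..t, Real.exp (k * s) = expInt k t := by
  rw [intervalIntegral.integral_comp_mul_left (fun x ↦ Real.exp x) hk, integral_exp, expInt]
  simp [div_eq_inv_mul]

/-- The covariance matrix of the example in closed form. -/
lemma covMatrix_exampleMatrix_apply (γ : ℝ) (t : ℝ≥0) (i j : Fin d) :
    covMatrix (exampleMatrix d) γ t i j = γ ^ 2 * ((if i = j then 1 else 0) * expInt 2 t +
      ((if (i : ℕ) = 0 then ((j : ℕ) + 1 : ℝ) else 0) +
        (if (j : ℕ) = 0 then ((i : ℕ) + 1 : ℝ) else 0)) * (expInt 3 t - expInt 2 t) +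
      ((i : ℕ) + 1) * ((j : ℕ) + 1) * (expInt 4 t - 2 * expInt 3 t + expInt 2 t)) := by
  have : NeZero d := ⟨fun h ↦ by subst h; exact i.elim0⟩
  have hz (j : Fin d) : ((j : ℕ) = 0) ↔ j = 0 := by rw [Fin.ext_iff, Fin.val_zero]
  set a : ℝ := if i = j then 1 else 0 with ha
  set b : ℝ := (if (i : ℕ) = 0 then ((j : ℕ) + 1 : ℝ) else 0) +
    (if (j : ℕ) = 0 then ((i : ℕ) + 1 : ℝ) else 0) with hb
  set c : ℝ := ((i : ℕ) + 1) * ((j : ℕ) + 1) with hc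
  have hentry (r : ℝ) : (NormedSpace.exp (r • exampleMatrix d) *
      (NormedSpace.exp (r • exampleMatrix d))ᵀ) i j =
      a * Real.exp (2 * r) + b * (Real.exp (3 * r) - Real.exp (2 * r)) +
        c * (Real.exp (4 * r) - 2 * Real.exp (3 * r) + Real.exp (2 * r)) := by
    have e2 : Real.exp (2 * r) = Real.exp r ^ 2 := by rw [← Real.exp_nat_mul]; norm_num
    have e3 : Real.exp (3 * r) = Real.exp r ^ 3 := by rw [← Real.exp_nat_mul]; norm_num
    have e4 : Real.exp (4 * r) = Real.exp r ^ 4 := by rw [← Real.exp_nat_mul]; norm_num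
    simp only [Matrix.mul_apply, Matrix.transpose_apply, exp_smul_exampleMatrix_apply, hz]
    simp only [add_mul, mul_add, Finset.sum_add_distrib, ite_mul, mul_ite, zero_mul, mul_zero,
      Finset.sum_ite_eq, Finset.sum_ite_eq', Finset.mem_univ, if_true]
    rw [ha, hb, hc, e2, e3, e4]
    simp only [hz]
    rcases eq_or_ne i j with rfl | hij
    · simp only [if_true]
      split_ifs <;> ring
    · simp only [hij, if_false]
      split_ifs <;> ring
  have hcont (k : ℝ) : IntervalIntegrable (fun s ↦ Real.exp (k * s)) volume 0 (t : ℝ) :=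
    Continuous.intervalIntegrable (by fun_prop) _ _
  -- Substituting `r = t - s` leaves a combination of `exp(2r)`, `exp(3r)` and `exp(4r)` to
  -- integrate.
  rw [covMatrix, Matrix.of_apply, intervalIntegral.integral_comp_sub_left (fun r ↦
    (NormedSpace.exp (r • exampleMatrix d) * (NormedSpace.exp (r • exampleMatrix d))ᵀ) i j)]
  simp_rw [hentry, sub_self, sub_zero]
  congr 1
  rw [intervalIntegral.integral_add, intervalIntegral.integral_add,
    intervalIntegral.integral_const_mul, intervalIntegral.integral_const_mul,
    intervalIntegral.integral_const_mul, intervalIntegral.integral_sub (hcont 3) (hcont 2),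
    intervalIntegral.integral_add, intervalIntegral.integral_sub,
    intervalIntegral.integral_const_mul, integral_exp_const_mul two_ne_zero,
    integral_exp_const_mul three_ne_zero, integral_exp_const_mul four_ne_zero]
  all_goals exact Continuous.intervalIntegrable (by fun_prop) _ _

lemma covMatrix_exampleMatrix_three (γ : ℝ) (t : ℝ≥0) :
    covMatrix (exampleMatrix 3) γ t = exampleCov3 γ t := by
  ext i j
  rw [covMatrix_exampleMatrix_apply, exampleCov3, Matrix.smul_apply, smul_eq_mul]
  congr 1
  fin_cases i <;> fin_cases j <;>
    -- The excluded simp lemmas would turn equations between products into disjunctions, which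
    -- `ring` cannot close.
    simp [-mul_eq_mul_left_iff, -mul_eq_mul_right_iff] <;> ring

end LocalGlobal

theorem mainTheorem5 {d : ℕ} [NeZero d] (γ : ℝ) (hγ : γ ≠ 0)
    {Ω : Type*} {mΩ : MeasurableSpace Ω} (P : Measure Ω) [IsProbabilityMeasure P]
    (ℱ : Filtration ℝ≥0 mΩ) (W : ℝ≥0 → Ω → EuclideanSpace ℝ (Fin d))
    (hW : LocalGlobal.IsBrownianMotion W ℱ P) :
    -- the drift is decoupled, the first coordinate being the global variable
    LocalGlobal.IsDecoupledDrift (0 : Fin d)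
      (LocalGlobal.linearDrift (LocalGlobal.exampleMatrix d)) ∧
    -- the SDE has a solution
    (∃ Θ, LocalGlobal.IsSDESolution (LocalGlobal.linearDrift (LocalGlobal.exampleMatrix d))
      γ 0 W ℱ P Θ) ∧
    -- every solution is the following Gauss–Markov process
    (∀ Θ, LocalGlobal.IsSDESolution (LocalGlobal.linearDrift (LocalGlobal.exampleMatrix d))
        γ 0 W ℱ P Θ →
      -- closed form: Θ_t = γ ∫_0^t exp(A (t - s)) dW_s
      (∀ t : ℝ≥0, ∃ Z : Fin d → Fin d → Ω → ℝ,
        (∀ i j, LocalGlobal.IsWienerIntegral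
          (fun s => NormedSpace.exp (((t : ℝ) - s) • LocalGlobal.exampleMatrix d) i j) t
          (fun r ω => W r ω j) P (Z i j)) ∧
        ∀ᵐ ω ∂P, ∀ i, Θ t ω i = γ * ∑ j, Z i j ω) ∧
      -- Gaussian process with mean zero and covariance matrix Σ(t)
      IsGaussianProcess Θ P ∧
      (∀ t i, P[fun ω => Θ t ω i] = 0) ∧
      (∀ t i j, cov[fun ω => Θ t ω i, fun ω => Θ t ω j; P] =
        LocalGlobal.covMatrix (LocalGlobal.exampleMatrix d) γ t i j) ∧
      (∀ t, HasLaw (Θ t)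
        (multivariateGaussian 0 (LocalGlobal.covMatrix (LocalGlobal.exampleMatrix d) γ t)) P) ∧
      -- Markov property, with the Gaussian transition laws
      (∀ s t : ℝ≥0, s ≤ t → ∀ B : Set (EuclideanSpace ℝ (Fin d)), MeasurableSet B →
        P⟦Θ t ⁻¹' B | ℱ s⟧ =ᵐ[P] fun ω =>
          (LocalGlobal.transitionLaw (LocalGlobal.exampleMatrix d) γ (t - s) (Θ s ω)).real B) ∧
      -- the density of Θ_t does not factor
      (∀ t : ℝ≥0, 0 < t → LocalGlobal.HasNonfactoringDensity (P.map (Θ t)))) ∧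
    -- the transition densities, from any starting point, do not factor
    (∀ t : ℝ≥0, 0 < t → ∀ x, LocalGlobal.HasNonfactoringDensity
      (LocalGlobal.transitionLaw (LocalGlobal.exampleMatrix d) γ t x)) ∧
    -- the covariance matrix is dense at all positive times
    (∀ t : ℝ≥0, 0 < t → ∀ i j,
      LocalGlobal.covMatrix (LocalGlobal.exampleMatrix d) γ t i j ≠ 0) ∧
    -- the covariance matrix in dimension three
    (∀ t : ℝ≥0, LocalGlobal.covMatrix (LocalGlobal.exampleMatrix 3) γ t =
      LocalGlobal.exampleCov3 γ t) := by
  have hne {t : ℝ≥0} (ht : 0 < t) (i j : Fin d) :=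
    LocalGlobal.covMatrix_exampleMatrix_ne_zero hγ ht i j
  have hpd {t : ℝ≥0} (ht : 0 < t) :=
    LocalGlobal.covMatrix_posDef (LocalGlobal.exampleMatrix d) hγ ht
  refine ⟨LocalGlobal.isDecoupledDrift_exampleMatrix, LocalGlobal.exists_isSDESolution hW _ γ,
    fun Θ hΘ ↦ ⟨hΘ.exists_isWienerIntegral hW, hΘ.isGaussianProcess hW, hΘ.integral_apply hW,
      hΘ.covariance_apply hW, hΘ.hasLaw hW, fun s t hst B hB ↦ hΘ.condExp_preimage hW hst hB,
      fun t ht ↦ ?_⟩, fun t ht x ↦ ?_, fun t ht ↦ hne ht,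
    LocalGlobal.covMatrix_exampleMatrix_three γ⟩
  · rw [(hΘ.hasLaw hW t).map_eq]
    exact LocalGlobal.hasNonfactoringDensity_multivariateGaussian 0 (hpd ht) (hne ht)
  · exact LocalGlobal.hasNonfactoringDensity_multivariateGaussian _ (hpd ht) (hne ht)
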